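/- **Proposition 2.1.** Let $X_1,X_2,\dots$ be i.i.d. real random variables with density $f$ with respect to the Lebesgue measure. Let $K:\mathbb R\to\mathbb R$ be a bounded probability density, symmetric around zero, with $$(\mathbf H_K)\qquad \int K(u)^2\,du<\infty,\qquad c_K:=\int u^2K(u)\,du<\infty,$$ and let $f$ be twice continuously differentiable on $\mathbb R$ with $(\mathbf H_f)$ $f$, $f'$ and $f''$ are bounded and square integrable. Assume further that $K$ has compact support and is twice continuously differentiable. For $h>0$ let $\hat f_h(x)=(nh)^{-1}\sum_{m=1}^nK\big(h^{-1}(X_m-x)\big)$ be the kernel estimator based on $X_1,\dots,X_n$. Let $k$ be fixed, and for each $n\ge 1$ let $h_1,\dots,h_k$ be almost surely positive random bandwidths (depending on $n$, and possibly on the data). Suppose that for each $i$ there is a deterministic bandwidth $h_i^*=h_{i,n}^*>0$ such that $h_i^*\asymp n^{-1/5}$, i.e. $c\,n^{-1/5}\le h_{i,n}^*\le C\,n^{-1/5}$ for all large $n$ with some constants $0<c\le C$, and $h_i-h_i^*=o_p(n^{-2/5})$. Let $\Sigma$, $A$, $B$ be the $k\times k$ matrices $$\Sigma_{ij}=\int\big(\hat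 f_{h_i}(x)-f(x)\big)\big(\hat f_{h_j}(x)-f(x)\big)\,dx,\qquad A_{ij}=\frac1{n\,h_ih_j}\int K(u/h_i)K(u/h_j)\,du,\qquad B_{ij}=\frac14h_i^2h_j^2c_K^2,$$ and let $\gamma=\int f''(x)^2\,dx$. Then, as $n\to\infty$, $$\Sigma=A+\gamma B+o_p(n^{-4/5})$$ (entrywise), where $Y_n=o_p(r_n)$ means that $Y_n/r_n\to0$ in probability. -/

import Mathlib

noncomputable section

namespace KDE

open MeasureTheory

/-- `g` is a probability density on `ℝ` with respect to the Lebesgue measure. -/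
structure IsDensity (g : ℝ → ℝ) : Prop where
  nonneg : ∀ x, 0 ≤ g x
  integrable : Integrable g
  integral_eq_one : ∫ x, g x = 1

/-- The standing assumptions on the kernel: a bounded density, symmetric around zero,
square integrable and with finite second moment. -/
structure KernelCond (K : ℝ → ℝ) : Prop where
  density : IsDensity K
  bounded : ∃ C, ∀ u, |K u| ≤ C
  symm : ∀ u, K (-u) = K u
  sq_integrable : Integrable (fun u => K u ^ 2)
  secondMoment_integrable : Integrable (fun u => u ^ 2 * K u)

/-- The standing assumptions on the unknown density: `f` is twice continuously differentiable,
and `f`, `f'`, `f''` are bounded and square integrable. -/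
structure DensityCond (f : ℝ → ℝ) : Prop where
  density : IsDensity f
  contDiff : ContDiff ℝ 2 f
  bounded : ∀ m ≤ 2, ∃ C, ∀ x, |iteratedDeriv m f x| ≤ C
  sq_integrable : ∀ m ≤ 2, Integrable (fun x => iteratedDeriv m f x ^ 2)

/-- `c_K = ∫ u² K(u) du`. -/
def secondMoment (K : ℝ → ℝ) : ℝ := ∫ u, u ^ 2 * K u

/-- `γ = ∫ f''(x)² dx`. -/
def curvature (f : ℝ → ℝ) : ℝ := ∫ x, iteratedDeriv 2 f x ^ 2

/-- The kernel estimator `x ↦ (n h)⁻¹ ∑ K (h⁻¹ (Xᵢ - x))` built from a sample of size `n`. -/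
def estimator (K : ℝ → ℝ) {n : ℕ} (X : Fin n → ℝ) (h x : ℝ) : ℝ :=
  (n * h)⁻¹ * ∑ m, K (h⁻¹ * (X m - x))

/-- The Gram matrix of the integrated cross errors of the kernel estimators. -/
def gram (K f : ℝ → ℝ) {n k : ℕ} (X : Fin n → ℝ) (h : Fin k → ℝ) :
    Matrix (Fin k) (Fin k) ℝ :=
  Matrix.of fun i j => ∫ x, (estimator K X (h i) x - f x) * (estimator K X (h j) x - f x)

/-- The variance part: `A i j = (n hᵢ hⱼ)⁻¹ ∫ K(u/hᵢ) K(u/hⱼ) du`. -/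
def matA (K : ℝ → ℝ) (n : ℕ) {k : ℕ} (h : Fin k → ℝ) : Matrix (Fin k) (Fin k) ℝ :=
  Matrix.of fun i j => (n * h i * h j)⁻¹ * ∫ u, K (u / h i) * K (u / h j)

/-- The squared bias part, without the factor `γ`: `B i j = hᵢ² hⱼ² c_K² / 4`. -/
def matB (K : ℝ → ℝ) {k : ℕ} (h : Fin k → ℝ) : Matrix (Fin k) (Fin k) ℝ :=
  Matrix.of fun i j => 1 / 4 * h i ^ 2 * h j ^ 2 * secondMoment K ^ 2

/-- `Y n = o_p(r n)` as `n → ∞`: the ratio `Y n / r n` tends to zero in probability. -/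
def IsLittleOp {Ω : Type*} [MeasurableSpace Ω] (P : Measure Ω) (Y : ℕ → Ω → ℝ) (r : ℕ → ℝ) :
    Prop :=
  TendstoInMeasure P (fun n ω => Y n ω / r n) Filter.atTop (fun _ => 0)

end KDE

end

/-!
Write `K_h = h⁻¹ K(h⁻¹ ·)`, `m_h x = E K_h (X - x)`, and `b_h = m_h - f` for the bias.

*Deterministic bandwidths.* Expanding the product of the two errors around the means gives a
quadratic statistic `n⁻² ∑ H(X_m, X_l)`, two centred linear statistics, and `∫ b_h b_k`. The kernel
`H` (`crossKernel`) is degenerate, so the off-diagonal terms are orthogonal up to exchange of the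
two indices, and their second moment is at most `2 n⁻² ∬ H²` (`integral_degenerate_sq_le`). Since
`|H| = O(1/h)` while `∬ |H|` stays bounded by a multiple of `sup f`, this is `O(n⁻² h⁻¹)`, which is
`o(n ^ (-8/5))`. The diagonal is deterministic up to `O(1/n)` and produces the variance term
`n⁻¹ ∫ K_h K_k`, which is the matrix `A`. The linear statistics have variance `O(h⁴ / n)`. Finally
`b_h = h² c_K f'' / 2 + o(h²)` in `L²`, by the Taylor formula with integral remainder and the
continuity of translations in `L²`; this gives the matrix `γ B`.

*Random bandwidths.* For `|h - k| ≤ δ` the fundamental theorem of calculus in the bandwidth and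
Cauchy–Schwarz bound the squared `L²` distance of the two estimators by
`2 δ ∫_{|s - k| ≤ δ} ‖∂_s f̂_s‖² ds`, a function of the sample alone (`bandwidthMajorant`). Whatever
the dependence of `h` on the data, only the mean of this majorant is needed. The derivative
`∂_s f̂_s` is, up to the factor `-1/s`, a kernel statistic with kernel `(u K(u))'`; its variance
part is `O(n⁻¹ s⁻³)`, and its mean is bounded in `L²` after an integration by parts, so the
majorant is `O(δ²)` in mean. With `δ = η n ^ (-2/5)` and `η` arbitrarily small, the estimators
at the random and at the deterministic bandwidths differ by `o_p(n ^ (-2/5))` in `L²`. As the error of the latter is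
`O_p(n ^ (-2/5))`, the cross errors differ by `o_p(n ^ (-4/5))`. The matrices `A` and `B` are
Lipschitz in the bandwidths, and change by `O_p(1/n)` only.
-/

noncomputable section

namespace KDE

open MeasureTheory ProbabilityTheory

/-! ### Second moments of linear and degenerate quadratic statistics -/

section Moments

variable {Ω : Type*} [MeasurableSpace Ω] {P : Measure Ω} [IsProbabilityMeasure P]
  {ι : Type*} {X : ι → Ω → ℝ} {μ : Measure ℝ}

/-- A bounded function of independent variables whose average over one of them vanishes has
mean zero. -/
lemma integral_eq_zero_of_iIndepFun [IsProbabilityMeasure μ] (hXm : ∀ i, Measurable (X i))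
    (hind : iIndepFun X P) (hlaw : ∀ i, P.map (X i) = μ) {S : Finset ι} {m : ι} (hm : m ∉ S)
    {G : ℝ × (S → ℝ) → ℝ} (hG : Measurable G) {C : ℝ} (hC : ∀ z, |G z| ≤ C)
    (h0 : ∀ z, ∫ y, G (y, z) ∂μ = 0) :
    ∫ ω, G (X m ω, fun i => X i ω) ∂P = 0 := by
  classical
  have h1 : IndepFun (fun ω (i : ({m} : Finset ι)) => X i ω) (fun ω (i : S) => X i ω) P :=
    hind.indepFun_finset {m} S (by simpa using hm) hXm
  have h2 : IndepFun (X m) (fun ω (i : S) => X i ω) P :=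
    h1.comp (φ := fun g : ({m} : Finset ι) → ℝ => g ⟨m, by simp⟩) (ψ := id)
      (measurable_pi_apply _) measurable_id
  have hS : Measurable (fun ω (i : S) => X i ω) := measurable_pi_lambda _ fun i => hXm i
  have h3 := (indepFun_iff_map_prod_eq_prod_map_map (hXm m).aemeasurable hS.aemeasurable).1 h2
  rw [hlaw] at h3
  have : IsProbabilityMeasure (P.map (fun ω (i : S) => X i ω)) :=
    Measure.isProbabilityMeasure_map hS.aemeasurable
  have h4 : ∫ ω, G (X m ω, fun i => X i ω) ∂P
      = ∫ z, G z ∂(μ.prod (P.map (fun ω (i : S) => X i ω))) := by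
    rw [← h3, integral_map ((hXm m).prodMk hS).aemeasurable hG.aestronglyMeasurable]
  have hint : Integrable G (μ.prod (P.map (fun ω (i : S) => X i ω))) :=
    .of_bound hG.aestronglyMeasurable C (.of_forall hC)
  rw [h4, integral_prod_symm _ hint]
  simp [h0]

/-- Two terms of a degenerate statistic are orthogonal when the index in the first place occurs in
none of the other three. -/
lemma integral_degenerate_mul_eq_zero [IsProbabilityMeasure μ] (hXm : ∀ i, Measurable (X i))
    (hind : iIndepFun X P) (hlaw : ∀ i, P.map (X i) = μ)
    {H H' : ℝ → ℝ → ℝ} (hH : Measurable (Function.uncurry H))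
    (hH' : Measurable (Function.uncurry H')) {C C' : ℝ}
    (hC : ∀ y z, |H y z| ≤ C) (hC' : ∀ y z, |H' y z| ≤ C') (h0 : ∀ z, ∫ y, H y z ∂μ = 0)
    {a b c d : ι} (hab : a ≠ b) (hac : a ≠ c) (had : a ≠ d) :
    ∫ ω, H (X a ω) (X b ω) * H' (X c ω) (X d ω) ∂P = 0 := by
  classical
  have hCnn : 0 ≤ C := (abs_nonneg _).trans (hC 0 0)
  let S : Finset ι := {b, c, d}
  let b' : S := ⟨b, by simp [S]⟩
  let c' : S := ⟨c, by simp [S]⟩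
  let d' : S := ⟨d, by simp [S]⟩
  refine integral_eq_zero_of_iIndepFun (S := S) (m := a) hXm hind hlaw (by simp [S, hab, hac, had])
    (G := fun w => H w.1 (w.2 b') * H' (w.2 c') (w.2 d')) (C := C * C') ?_ ?_ ?_
  · have e1 : Measurable fun w : ℝ × (S → ℝ) => (w.1, w.2 b') := by fun_prop
    have e2 : Measurable fun w : ℝ × (S → ℝ) => (w.2 c', w.2 d') := by fun_prop
    exact (hH.comp e1).mul (hH'.comp e2)
  · intro w
    rw [abs_mul]
    exact mul_le_mul (hC _ _) (hC' _ _) (abs_nonneg _) hCnn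
  · intro z
    change ∫ y, H y (z b') * H' (z c') (z d') ∂μ = 0
    rw [integral_mul_const, h0, zero_mul]

/-- The joint law of two distinct observations is the product law. -/
lemma integral_comp_pair [IsProbabilityMeasure μ] (hXm : ∀ i, Measurable (X i))
    (hind : iIndepFun X P) (hlaw : ∀ i, P.map (X i) = μ)
    {H : ℝ → ℝ → ℝ} (hH : Measurable (Function.uncurry H)) {C : ℝ} (hC : ∀ y z, |H y z| ≤ C)
    {a b : ι} (hab : a ≠ b) :
    ∫ ω, H (X a ω) (X b ω) ∂P = ∫ y, ∫ z, H y z ∂μ ∂μ := by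
  have h3 := (indepFun_iff_map_prod_eq_prod_map_map (hXm a).aemeasurable
    (hXm b).aemeasurable).1 (hind.indepFun hab)
  rw [hlaw, hlaw] at h3
  have hint : Integrable (Function.uncurry H) (μ.prod μ) :=
    .of_bound hH.aestronglyMeasurable C (.of_forall fun w => hC w.1 w.2)
  have h4 : ∫ ω, H (X a ω) (X b ω) ∂P = ∫ z, Function.uncurry H z ∂(μ.prod μ) := by
    rw [← h3, integral_map ((hXm a).prodMk (hXm b)).aemeasurable hH.aestronglyMeasurable]
    rfl
  rw [h4, integral_prod _ hint]
  rfl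

/-- The second moment of a degenerate U-statistic. Expanding the square, two terms are orthogonal
unless they involve the same unordered pair of observations. -/
lemma integral_degenerate_sq_le [IsProbabilityMeasure μ] [Fintype ι] [DecidableEq ι]
    (hXm : ∀ i, Measurable (X i))
    (hind : iIndepFun X P) (hlaw : ∀ i, P.map (X i) = μ)
    {H : ℝ → ℝ → ℝ} (hH : Measurable (Function.uncurry H)) {C : ℝ} (hC : ∀ y z, |H y z| ≤ C)
    (h1 : ∀ z, ∫ y, H y z ∂μ = 0) (h2 : ∀ y, ∫ z, H y z ∂μ = 0) :
    ∫ ω, (∑ a ∈ Finset.univ.offDiag, H (X a.1 ω) (X a.2 ω)) ^ 2 ∂P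
      ≤ 2 * (Fintype.card ι : ℝ) ^ 2 * ∫ y, ∫ z, H y z ^ 2 ∂μ ∂μ := by
  have hCnn : 0 ≤ C := (abs_nonneg _).trans (hC 0 0)
  set V := ∫ y, ∫ z, H y z ^ 2 ∂μ ∂μ with hV
  have hVnn : 0 ≤ V := integral_nonneg fun y => integral_nonneg fun z => sq_nonneg _
  have hmeas : ∀ a b, Measurable fun ω => H (X a ω) (X b ω) := fun a b =>
    hH.comp ((hXm a).prodMk (hXm b))
  have hint : ∀ a b c d : ι, Integrable (fun ω => H (X a ω) (X b ω) * H (X c ω) (X d ω)) P := by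
    intro a b c d
    refine .of_bound ((hmeas a b).mul (hmeas c d)).aestronglyMeasurable (C * C) (.of_forall ?_)
    intro ω
    rw [Real.norm_eq_abs, abs_mul]
    exact mul_le_mul (hC _ _) (hC _ _) (abs_nonneg _) hCnn
  have hH' : Measurable (Function.uncurry fun y z => H z y) := hH.comp measurable_swap
  have hsq : ∀ a b : ι, a ≠ b → ∫ ω, H (X a ω) (X b ω) ^ 2 ∂P = V := by
    intro a b hab
    refine integral_comp_pair (H := fun y z => H y z ^ 2) hXm hind hlaw (hH.pow_const 2)
      (C := C ^ 2) (fun y z => ?_) hab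
    rw [abs_pow]
    exact pow_le_pow_left₀ (abs_nonneg _) (hC _ _) 2
  have horth : ∀ a b c d : ι, a ≠ b → c ≠ d → ¬ (c = a ∧ d = b) → ¬ (c = b ∧ d = a) →
      ∫ ω, H (X a ω) (X b ω) * H (X c ω) (X d ω) ∂P = 0 := by
    intro a b c d hab hcd hn1 hn2
    -- as `{c, d} ≠ {a, b}`, one of `a`, `b` is different from both `c` and `d`
    by_cases ha : a ≠ c ∧ a ≠ d
    · exact integral_degenerate_mul_eq_zero hXm hind hlaw hH hH hC hC h1 hab ha.1 ha.2
    · have hb : b ≠ c ∧ b ≠ d := by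
        constructor
        · rintro rfl; apply hn2; refine ⟨rfl, ?_⟩; by_contra h; exact ha ⟨hab, fun e => h e.symm⟩
        · rintro rfl; apply hn1; refine ⟨?_, rfl⟩; by_contra h; exact ha ⟨fun e => h e.symm, hab⟩
      exact integral_degenerate_mul_eq_zero (H := fun y z => H z y) hXm hind hlaw hH' hH
        (fun y z => hC z y) hC h2 hab.symm hb.1 hb.2
  have hterm : ∀ a ∈ (Finset.univ : Finset ι).offDiag,
      ∑ c ∈ (Finset.univ : Finset ι).offDiag,
        ∫ ω, H (X a.1 ω) (X a.2 ω) * H (X c.1 ω) (X c.2 ω) ∂P ≤ 2 * V := by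
    intro a ha
    have hab : a.1 ≠ a.2 := by simpa using ha
    have hsub : ({(a.1, a.2), (a.2, a.1)} : Finset (ι × ι)) ⊆ Finset.univ.offDiag := by
      intro c hc
      simp only [Finset.mem_insert, Finset.mem_singleton] at hc
      rcases hc with rfl | rfl
      · simpa using hab
      · simpa using hab.symm
    rw [← Finset.sum_subset hsub]
    · rw [Finset.sum_pair (by simp [Prod.ext_iff, hab])]
      have e1 : ∫ ω, H (X a.1 ω) (X a.2 ω) * H (X a.1 ω) (X a.2 ω) ∂P = V := by
        simp_rw [← sq]; exact hsq _ _ hab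
      have e2 : ∫ ω, H (X a.1 ω) (X a.2 ω) * H (X a.2 ω) (X a.1 ω) ∂P ≤ V := by
        have e3 : ∫ ω, H (X a.1 ω) (X a.2 ω) * H (X a.2 ω) (X a.1 ω) ∂P
            ≤ ∫ ω, (1 / 2) * (H (X a.1 ω) (X a.2 ω) * H (X a.1 ω) (X a.2 ω)
              + H (X a.2 ω) (X a.1 ω) * H (X a.2 ω) (X a.1 ω)) ∂P := by
          refine integral_mono (hint _ _ _ _) (((hint _ _ _ _).add (hint _ _ _ _)).const_mul _) ?_
          intro ω
          simp only
          nlinarith [sq_nonneg (H (X a.1 ω) (X a.2 ω) - H (X a.2 ω) (X a.1 ω))]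
        rw [integral_const_mul, integral_add (hint _ _ _ _) (hint _ _ _ _)] at e3
        simp_rw [← sq] at e3
        rw [hsq _ _ hab, hsq _ _ hab.symm] at e3
        linarith
      linarith
    · intro c hc hc'
      have hcd : c.1 ≠ c.2 := by simpa using hc
      simp only [Finset.mem_insert, Finset.mem_singleton, not_or, Prod.ext_iff] at hc'
      exact horth _ _ _ _ hab hcd hc'.1 hc'.2
  calc ∫ ω, (∑ a ∈ Finset.univ.offDiag, H (X a.1 ω) (X a.2 ω)) ^ 2 ∂P
      = ∑ a ∈ (Finset.univ : Finset ι).offDiag, ∑ c ∈ (Finset.univ : Finset ι).offDiag,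
        ∫ ω, H (X a.1 ω) (X a.2 ω) * H (X c.1 ω) (X c.2 ω) ∂P := by
        simp_rw [sq, Finset.sum_mul_sum]
        rw [integral_finsetSum _ fun a _ => integrable_finsetSum _ fun c _ => hint _ _ _ _]
        refine Finset.sum_congr rfl fun a _ => ?_
        rw [integral_finsetSum _ fun c _ => hint _ _ _ _]
    _ ≤ ∑ a ∈ (Finset.univ : Finset ι).offDiag, 2 * V := Finset.sum_le_sum hterm
    _ = ((Finset.univ : Finset ι).offDiag.card : ℝ) * (2 * V) := by simp
    _ ≤ (Fintype.card ι : ℝ) ^ 2 * (2 * V) := by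
        gcongr
        rw [Finset.offDiag_card, Finset.card_univ, sq]
        exact_mod_cast Nat.sub_le _ _
    _ = _ := by ring

/-- The variance of an empirical mean. -/
lemma integral_empirical_sq_le [IsProbabilityMeasure μ] {n : ℕ} {X : Fin n → Ω → ℝ}
    (hXm : ∀ i, Measurable (X i)) (hind : iIndepFun X P) (hlaw : ∀ i, P.map (X i) = μ)
    {ψ : ℝ → ℝ} (hψ : Measurable ψ) {C : ℝ} (hC : ∀ y, |ψ y| ≤ C) (hn : 1 ≤ n) :
    ∫ ω, ((n : ℝ)⁻¹ * ∑ m, ψ (X m ω) - ∫ y, ψ y ∂μ) ^ 2 ∂P ≤ (n : ℝ)⁻¹ * ∫ y, ψ y ^ 2 ∂μ := by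
  have hn0 : (n : ℝ) ≠ 0 := by positivity
  have hmem : ∀ m, MemLp (fun ω => ψ (X m ω)) 2 P := fun m =>
    .of_bound (hψ.comp (hXm m)).aestronglyMeasurable C (.of_forall fun ω => hC _)
  have hmean : ∀ m, ∫ ω, ψ (X m ω) ∂P = ∫ y, ψ y ∂μ := fun m => by
    rw [← hlaw m, integral_map (hXm m).aemeasurable hψ.aestronglyMeasurable]
  have hsqm : ∀ m, ∫ ω, ψ (X m ω) ^ 2 ∂P = ∫ y, ψ y ^ 2 ∂μ := fun m => by
    rw [← hlaw m, integral_map (hXm m).aemeasurable (hψ.pow_const 2).aestronglyMeasurable]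
  have hES : ∫ ω, (n : ℝ)⁻¹ * ∑ m, ψ (X m ω) ∂P = ∫ y, ψ y ∂μ := by
    rw [integral_const_mul, integral_finsetSum _ fun m _ => (hmem m).integrable (by norm_num)]
    simp [hmean, hn0]
  have hmS : AEMeasurable (fun ω => (n : ℝ)⁻¹ * ∑ m, ψ (X m ω)) P :=
    (Measurable.const_mul (Finset.measurable_sum _ fun m _ => hψ.comp (hXm m)) _).aemeasurable
  have hvar := variance_eq_integral hmS
  rw [hES] at hvar
  rw [← hvar, variance_const_mul]
  have hsum := IndepFun.variance_sum (X := fun m ω => ψ (X m ω)) (s := Finset.univ) (μ := P)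
    (fun m _ => hmem m)
    (fun a _ b _ hab => (hind.indepFun hab).comp hψ hψ)
  have he : (∑ m, fun ω => ψ (X m ω)) = fun ω => ∑ m, ψ (X m ω) := by
    ext ω; simp
  rw [he] at hsum
  rw [hsum]
  have hle : ∑ m, Var[fun ω => ψ (X m ω); P] ≤ ∑ _m : Fin n, ∫ y, ψ y ^ 2 ∂μ := by
    refine Finset.sum_le_sum fun m _ => ?_
    refine (variance_le_expectation_sq (hψ.comp (hXm m)).aestronglyMeasurable).trans ?_
    rw [← hsqm m]
    rfl
  calc _ ≤ ((n : ℝ)⁻¹) ^ 2 * ∑ _m : Fin n, ∫ y, ψ y ^ 2 ∂μ := by gcongr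
    _ = _ := by simp; field_simp

end Moments

/-! ### The Gram matrix as a degenerate quadratic statistic -/

/-- The class `L¹ ∩ L^∞` (with an everywhere bound), which is closed under products. -/
structure BddIntegrable (v : ℝ → ℝ) : Prop where
  integrable : Integrable v
  bounded : ∃ C, ∀ x, |v x| ≤ C

namespace BddIntegrable

variable {v w : ℝ → ℝ}

lemma add (hv : BddIntegrable v) (hw : BddIntegrable w) : BddIntegrable fun x => v x + w x := by
  obtain ⟨C, hC⟩ := hv.bounded
  obtain ⟨D, hD⟩ := hw.bounded
  exact ⟨hv.integrable.add hw.integrable, C + D, fun x =>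
    (abs_add_le _ _).trans (add_le_add (hC x) (hD x))⟩

lemma const_mul (hv : BddIntegrable v) (c : ℝ) : BddIntegrable fun x => c * v x := by
  obtain ⟨C, hC⟩ := hv.bounded
  refine ⟨hv.integrable.const_mul c, |c| * C, fun x => ?_⟩
  rw [abs_mul]
  exact mul_le_mul_of_nonneg_left (hC x) (abs_nonneg _)

lemma sub (hv : BddIntegrable v) (hw : BddIntegrable w) : BddIntegrable fun x => v x - w x := by
  simpa [sub_eq_add_neg] using hv.add (hw.const_mul (-1))

lemma sum {ι : Type*} {s : Finset ι} {g : ι → ℝ → ℝ} (hg : ∀ i, BddIntegrable (g i)) :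
    BddIntegrable fun x => ∑ i ∈ s, g i x := by
  classical
  induction s using Finset.induction_on with
  | empty => simpa using ⟨integrable_zero _ _ _, 0, by simp⟩
  | insert a s ha ih => simpa [Finset.sum_insert ha] using (hg a).add ih

lemma integrable_mul (hv : BddIntegrable v) (hw : BddIntegrable w) :
    Integrable fun x => v x * w x := by
  obtain ⟨C, hC⟩ := hv.bounded
  exact hw.integrable.bdd_mul hv.integrable.aestronglyMeasurable (.of_forall hC)

end BddIntegrable

/-- The expectation `x ↦ E p (X - x)` of a kernel statistic when `X` has law `μ`. -/
def smooth (μ : Measure ℝ) (p : ℝ → ℝ) (x : ℝ) : ℝ := ∫ y, p (y - x) ∂μ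

/-- The centred kernel statistic `p (y - x) - E p (X - x)`. -/
def centered (μ : Measure ℝ) (p : ℝ → ℝ) (y x : ℝ) : ℝ := p (y - x) - smooth μ p x

/-- The degenerate kernel of the quadratic statistic: the `L²` inner product of two centred
kernel statistics. -/
def crossKernel (μ : Measure ℝ) (p q : ℝ → ℝ) (y z : ℝ) : ℝ :=
  ∫ x, centered μ p y x * centered μ q z x

/-- A continuous probability density bounded by `M`. -/
structure Window (p : ℝ → ℝ) (M : ℝ) : Prop where
  density : IsDensity p
  cont : Continuous p
  le : ∀ x, p x ≤ M

section Window

variable {μ : Measure ℝ} {F : ℝ} {p q : ℝ → ℝ} {M N : ℝ}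

lemma Window.bound_nonneg (hp : Window p M) : 0 ≤ M := (hp.density.nonneg 0).trans (hp.le 0)

lemma Window.bddIntegrable (hp : Window p M) (y : ℝ) : BddIntegrable fun x => p (y - x) :=
  ⟨hp.density.integrable.comp_sub_left y, M, fun x => by
    rw [abs_of_nonneg (hp.density.nonneg _)]; exact hp.le _⟩

lemma Window.integral_shift (hp : Window p M) (y : ℝ) : ∫ x, p (y - x) = 1 := by
  rw [integral_sub_left_eq_self p volume y, hp.density.integral_eq_one]

lemma Window.smooth_nonneg (hp : Window p M) (x : ℝ) : 0 ≤ smooth μ p x :=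
  integral_nonneg fun _ => hp.density.nonneg _

/-- An integral against a law with density at most `F` is at most `F` times the Lebesgue
integral. -/
lemma integral_law_le (hF : 0 ≤ F) (hμ : μ ≤ ENNReal.ofReal F • volume) {g : ℝ → ℝ}
    (h0 : ∀ x, 0 ≤ g x) (hg : Integrable g) : ∫ y, g y ∂μ ≤ F * ∫ y, g y := by
  have h1 : ∫ y, g y ∂μ ≤ ∫ y, g y ∂(ENNReal.ofReal F • volume) :=
    integral_mono_measure hμ (.of_forall h0) (hg.smul_measure (by simp))
  rwa [integral_smul_measure, ENNReal.toReal_ofReal hF, smul_eq_mul] at h1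

lemma Window.smooth_le_density (hp : Window p M) (hF : 0 ≤ F)
    (hμ : μ ≤ ENNReal.ofReal F • volume) (x : ℝ) : smooth μ p x ≤ F := by
  have := integral_law_le hF hμ (fun y => hp.density.nonneg (y - x))
    (hp.density.integrable.comp_sub_right x)
  rwa [integral_sub_right_eq_self (μ := volume) p, hp.density.integral_eq_one, mul_one] at this

lemma Window.abs_centered_le_add (hp : Window p M) (y x : ℝ) :
    |centered μ p y x| ≤ p (y - x) + smooth μ p x := by
  have h1 := hp.density.nonneg (y - x)
  have h3 := hp.smooth_nonneg (μ := μ) x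
  rw [centered, abs_le]
  constructor <;> linarith

variable [IsProbabilityMeasure μ]

lemma Window.integrable_law (hp : Window p M) (x : ℝ) : Integrable (fun y => p (y - x)) μ := by
  refine .of_bound (hp.cont.comp (continuous_sub_right x)).aestronglyMeasurable M
    (.of_forall fun y => ?_)
  rw [Real.norm_eq_abs, abs_of_nonneg (hp.density.nonneg _)]
  exact hp.le _

lemma Window.smooth_le (hp : Window p M) (x : ℝ) : smooth μ p x ≤ M := by
  have := integral_mono (hp.integrable_law (μ := μ) x) (integrable_const M) fun y => hp.le (y - x)
  simpa [smooth] using this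

lemma measurable_smooth (hp : Measurable p) : Measurable (smooth μ p) := by
  have : StronglyMeasurable (Function.uncurry fun x y : ℝ => p (y - x)) :=
    (hp.comp (measurable_snd.sub measurable_fst)).stronglyMeasurable
  exact this.integral_prod_right.measurable

lemma Window.integrable_prod (hp : Window p M) :
    Integrable (fun w : ℝ × ℝ => p (w.2 - w.1)) (volume.prod μ) := by
  have hm : Continuous fun w : ℝ × ℝ => p (w.2 - w.1) :=
    hp.cont.comp (continuous_snd.sub continuous_fst)
  rw [integrable_prod_iff' hm.aestronglyMeasurable]
  refine ⟨.of_forall fun y => (hp.bddIntegrable y).integrable, ?_⟩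
  have : ∀ y, ∫ x, ‖p (y - x)‖ = 1 := fun y => by
    rw [← hp.integral_shift y]
    exact integral_congr_ae (.of_forall fun x => abs_of_nonneg (hp.density.nonneg _))
  simp only [this]
  exact integrable_const _

lemma Window.smooth_bddIntegrable (hp : Window p M) : BddIntegrable (smooth μ p) :=
  ⟨hp.integrable_prod.integral_prod_left, M, fun x => by
    rw [abs_of_nonneg (hp.smooth_nonneg x)]; exact hp.smooth_le x⟩

lemma Window.integral_smooth (hp : Window p M) : ∫ x, smooth μ p x = 1 := by
  have := integral_integral_swap (f := fun x y => p (y - x)) (hp.integrable_prod (μ := μ))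
  unfold smooth
  rw [this]
  simp [hp.integral_shift]

lemma measurable_centered (hp : Measurable p) :
    Measurable (Function.uncurry (centered μ p)) :=
  (hp.comp (measurable_fst.sub measurable_snd)).sub ((measurable_smooth hp).comp measurable_snd)

lemma Window.centered_bddIntegrable (hp : Window p M) (y : ℝ) :
    BddIntegrable (centered μ p y) := (hp.bddIntegrable y).sub hp.smooth_bddIntegrable

lemma Window.abs_centered_le (hp : Window p M) (y x : ℝ) : |centered μ p y x| ≤ M := by
  have h1 := hp.density.nonneg (y - x)
  have h2 := hp.le (y - x)
  have h3 := hp.smooth_nonneg (μ := μ) x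
  have h4 := hp.smooth_le (μ := μ) x
  rw [centered, abs_le]
  constructor <;> linarith

lemma Window.integral_abs_centered_le (hp : Window p M) (y : ℝ) :
    ∫ x, |centered μ p y x| ≤ 2 := by
  have h := integral_mono (hp.centered_bddIntegrable (μ := μ) y).integrable.abs
    ((hp.bddIntegrable y).integrable.add (hp.smooth_bddIntegrable (μ := μ)).integrable)
    (fun x => hp.abs_centered_le_add y x)
  have h2 := integral_add (hp.bddIntegrable y).integrable
    (hp.smooth_bddIntegrable (μ := μ)).integrable
  rw [hp.integral_shift, hp.integral_smooth] at h2
  calc _ ≤ _ := h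
    _ = _ := h2
    _ = 2 := by norm_num

lemma Window.integral_centered (hp : Window p M) (x : ℝ) : ∫ y, centered μ p y x ∂μ = 0 := by
  unfold centered
  rw [integral_sub (hp.integrable_law x) (integrable_const _)]
  simp [smooth]

lemma Window.integral_integral_centered_mul (hp : Window p M) {v : ℝ → ℝ} (hv : Integrable v) :
    ∫ y, (∫ x, centered μ p y x * v x) ∂μ = 0 := by
  have hint : Integrable (Function.uncurry fun y x => centered μ p y x * v x)
      (μ.prod volume) := by
    refine (hv.comp_snd μ).bdd_mul (c := M)
      (measurable_centered hp.cont.measurable).aestronglyMeasurable (.of_forall fun w => ?_)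
    exact hp.abs_centered_le w.1 w.2
  rw [integral_integral_swap hint]
  simp [integral_mul_const, hp.integral_centered]

lemma Window.abs_integral_centered_mul_le (hp : Window p M) {v : ℝ → ℝ} {C : ℝ}
    (hC : ∀ x, |v x| ≤ C) (y : ℝ) : |∫ x, centered μ p y x * v x| ≤ 2 * C := by
  have hCnn : 0 ≤ C := (abs_nonneg _).trans (hC 0)
  calc |∫ x, centered μ p y x * v x| ≤ ∫ x, C * |centered μ p y x| := by
        refine norm_integral_le_of_norm_le (f := fun x => centered μ p y x * v x)
          ((hp.centered_bddIntegrable y).integrable.abs.const_mul C) (.of_forall fun x => ?_)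
        rw [Real.norm_eq_abs, abs_mul, mul_comm]
        exact mul_le_mul_of_nonneg_right (hC x) (abs_nonneg _)
    _ ≤ C * 2 := by
        rw [integral_const_mul]
        exact mul_le_mul_of_nonneg_left (hp.integral_abs_centered_le y) hCnn
    _ = _ := mul_comm _ _

lemma measurable_integral_centered_mul (hp : Measurable p) {v : ℝ → ℝ} (hv : Measurable v) :
    Measurable fun y => ∫ x, centered μ p y x * v x := by
  have : StronglyMeasurable (Function.uncurry fun y x : ℝ => centered μ p y x * v x) :=
    ((measurable_centered hp).mul (hv.comp measurable_snd)).stronglyMeasurable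
  exact this.integral_prod_right.measurable

lemma measurable_crossKernel (hp : Measurable p) (hq : Measurable q) :
    Measurable (Function.uncurry (crossKernel μ p q)) := by
  have e1 : Measurable fun w : (ℝ × ℝ) × ℝ => (w.1.1, w.2) := by fun_prop
  have e2 : Measurable fun w : (ℝ × ℝ) × ℝ => (w.1.2, w.2) := by fun_prop
  have : StronglyMeasurable (Function.uncurry fun (w : ℝ × ℝ) (x : ℝ) =>
      centered μ p w.1 x * centered μ q w.2 x) :=
    (((measurable_centered hp).comp e1).mul ((measurable_centered hq).comp e2)).stronglyMeasurable
  exact this.integral_prod_right.measurable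

lemma Window.abs_crossKernel_le (hp : Window p M) (hq : Window q N) (y z : ℝ) :
    |crossKernel μ p q y z| ≤ 2 * N :=
  hp.abs_integral_centered_mul_le (fun x => hq.abs_centered_le z x) y

lemma Window.integral_crossKernel_left (hp : Window p M) (hq : Window q N) (z : ℝ) :
    ∫ y, crossKernel μ p q y z ∂μ = 0 :=
  hp.integral_integral_centered_mul (hq.centered_bddIntegrable z).integrable

lemma Window.integral_crossKernel_right (hp : Window p M) (hq : Window q N) (y : ℝ) :
    ∫ z, crossKernel μ p q y z ∂μ = 0 := by
  have := hq.integral_integral_centered_mul (μ := μ)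
    (hp.centered_bddIntegrable (μ := μ) y).integrable
  simpa only [crossKernel, mul_comm] using this

/-- The `L¹` norm of the degenerate kernel stays bounded however concentrated the windows are,
while its supremum grows like the height of a window; interpolating gives the `L²` bound
`integral_crossKernel_sq_le`. -/
lemma Window.integral_abs_crossKernel_le (hp : Window p M) (hq : Window q N) (hF : 0 ≤ F)
    (hμ : μ ≤ ENNReal.ofReal F • volume) (y : ℝ) :
    ∫ z, |crossKernel μ p q y z| ∂μ ≤ 4 * F := by
  have hcp := (hp.centered_bddIntegrable (μ := μ) y).integrable.abs
  have hmeas2 : Measurable (Function.uncurry fun z x => q (z - x) + smooth μ q x) :=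
    (hq.cont.measurable.comp (measurable_fst.sub measurable_snd)).add
      ((measurable_smooth hq.cont.measurable).comp measurable_snd)
  have hint : Integrable (Function.uncurry fun z x =>
      (q (z - x) + smooth μ q x) * |centered μ p y x|) (μ.prod volume) := by
    refine (hcp.comp_snd μ).bdd_mul (c := 2 * N) hmeas2.aestronglyMeasurable
      (.of_forall fun w => ?_)
    have h1 := hq.density.nonneg (w.1 - w.2)
    have h2 := hq.le (w.1 - w.2)
    have h3 := hq.smooth_nonneg (μ := μ) w.2
    have h4 := hq.smooth_le (μ := μ) w.2
    change |q (w.1 - w.2) + smooth μ q w.2| ≤ 2 * N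
    rw [abs_of_nonneg (by linarith)]
    linarith
  have hmH : Measurable fun z => |crossKernel μ p q y z| :=
    ((measurable_crossKernel hp.cont.measurable hq.cont.measurable).comp
      measurable_prodMk_left).abs
  calc ∫ z, |crossKernel μ p q y z| ∂μ
      ≤ ∫ z, (∫ x, (q (z - x) + smooth μ q x) * |centered μ p y x|) ∂μ := by
        refine integral_mono_of_nonneg (.of_forall fun _ => abs_nonneg _)
          hint.integral_prod_left (.of_forall fun z => ?_)
        refine norm_integral_le_of_norm_le
          (f := fun x => centered μ p y x * centered μ q z x) ?_ (.of_forall fun x => ?_)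
        · exact BddIntegrable.integrable_mul
            ((hq.bddIntegrable z).add hq.smooth_bddIntegrable)
            ⟨hcp, M, fun x => by rw [abs_abs]; exact hp.abs_centered_le y x⟩
        · rw [Real.norm_eq_abs, abs_mul, mul_comm]
          exact mul_le_mul_of_nonneg_right (hq.abs_centered_le_add z x) (abs_nonneg _)
    _ = ∫ x, 2 * smooth μ q x * |centered μ p y x| := by
        rw [integral_integral_swap hint]
        refine integral_congr_ae (.of_forall fun x => ?_)
        simp only
        rw [integral_mul_const, integral_add (hq.integrable_law x) (integrable_const _)]
        simp [smooth, two_mul]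
    _ ≤ ∫ x, 2 * F * |centered μ p y x| := by
        refine integral_mono_of_nonneg (.of_forall fun x => ?_) (hcp.const_mul _)
          (.of_forall fun x => ?_)
        · have := hq.smooth_nonneg (μ := μ) x
          positivity
        · have := hq.smooth_le_density hF hμ x
          simp only
          gcongr
    _ ≤ 2 * F * 2 := by
        rw [integral_const_mul]
        exact mul_le_mul_of_nonneg_left (hp.integral_abs_centered_le y) (by positivity)
    _ = _ := by ring

lemma Window.integral_crossKernel_sq_le (hp : Window p M) (hq : Window q N) (hF : 0 ≤ F)
    (hμ : μ ≤ ENNReal.ofReal F • volume) :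
    ∫ y, ∫ z, crossKernel μ p q y z ^ 2 ∂μ ∂μ ≤ 8 * N * F := by
  have hN := hq.bound_nonneg
  have key : ∀ y, ∫ z, crossKernel μ p q y z ^ 2 ∂μ ≤ 8 * N * F := by
    intro y
    have hmH : Measurable fun z => |crossKernel μ p q y z| :=
      ((measurable_crossKernel hp.cont.measurable hq.cont.measurable).comp
        measurable_prodMk_left).abs
    have hi : Integrable (fun z => |crossKernel μ p q y z|) μ :=
      .of_bound hmH.aestronglyMeasurable (2 * N) (.of_forall fun z => by
        rw [Real.norm_eq_abs, abs_abs]; exact hp.abs_crossKernel_le hq y z)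
    calc ∫ z, crossKernel μ p q y z ^ 2 ∂μ ≤ ∫ z, 2 * N * |crossKernel μ p q y z| ∂μ := by
          refine integral_mono_of_nonneg (.of_forall fun _ => sq_nonneg _) (hi.const_mul _)
            (.of_forall fun z => ?_)
          simp only
          rw [← sq_abs, sq]
          exact mul_le_mul_of_nonneg_right (hp.abs_crossKernel_le hq y z) (abs_nonneg _)
      _ ≤ 2 * N * (4 * F) := by
          rw [integral_const_mul]
          exact mul_le_mul_of_nonneg_left (hp.integral_abs_crossKernel_le hq hF hμ y)
            (by positivity)
      _ = _ := by ring
  have := integral_mono_of_nonneg (μ := μ)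
    (.of_forall fun y => integral_nonneg fun z => sq_nonneg (crossKernel μ p q y z))
    (integrable_const (8 * N * F)) (.of_forall key)
  simpa using this

/-- On the diagonal the degenerate kernel is deterministic up to a bounded error. -/
lemma Window.abs_crossKernel_diag_sub_le (hp : Window p M) (hq : Window q N) (hF : 0 ≤ F)
    (hμ : μ ≤ ENNReal.ofReal F • volume) (y : ℝ) :
    |crossKernel μ p q y y - ∫ u, p u * q u| ≤ 2 * F := by
  have hmp := hp.smooth_bddIntegrable (μ := μ)
  have hmq := hq.smooth_bddIntegrable (μ := μ)
  have hpp := hp.bddIntegrable y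
  have hqq := hq.bddIntegrable y
  have hle : ∀ {v w : ℝ → ℝ}, BddIntegrable v → BddIntegrable w → (∀ x, 0 ≤ v x) →
      (∀ x, 0 ≤ w x) → (∀ x, w x ≤ F) → ∫ x, v x = 1 →
      0 ≤ ∫ x, v x * w x ∧ ∫ x, v x * w x ≤ F := by
    intro v w hv hw hv0 hw0 hwF hv1
    refine ⟨integral_nonneg fun x => mul_nonneg (hv0 x) (hw0 x), ?_⟩
    have := integral_mono (hv.integrable_mul hw) (hv.integrable.mul_const F)
      fun x => mul_le_mul_of_nonneg_left (hwF x) (hv0 x)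
    simpa [integral_mul_const, hv1] using this
  have h1 := hle hpp hmq (fun x => hp.density.nonneg _) hq.smooth_nonneg
    (hq.smooth_le_density hF hμ) (hp.integral_shift y)
  have h2 := hle hqq hmp (fun x => hq.density.nonneg _) hp.smooth_nonneg
    (hp.smooth_le_density hF hμ) (hq.integral_shift y)
  have h3 := hle hmp hmq hp.smooth_nonneg hq.smooth_nonneg
    (hq.smooth_le_density hF hμ) hp.integral_smooth
  have h4 : ∫ x, p (y - x) * q (y - x) = ∫ u, p u * q u :=
    integral_sub_left_eq_self (fun u => p u * q u) volume y
  have h5 : crossKernel μ p q y y = (∫ x, p (y - x) * q (y - x))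
      - (∫ x, p (y - x) * smooth μ q x) - (∫ x, q (y - x) * smooth μ p x)
      + ∫ x, smooth μ p x * smooth μ q x := by
    have i1 := (hpp.integrable_mul hqq).sub (hpp.integrable_mul hmq)
    have i2 := i1.sub (hqq.integrable_mul hmp)
    rw [← integral_sub (hpp.integrable_mul hqq) (hpp.integrable_mul hmq)]
    erw [← integral_sub i1 (hqq.integrable_mul hmp), ← integral_add i2 (hmp.integrable_mul hmq)]
    refine integral_congr_ae (.of_forall fun x => ?_)
    simp only [centered, Pi.sub_apply]
    ring
  rw [h5, h4, abs_le]
  constructor <;> linarith [h1.1, h1.2, h2.1, h2.2, h3.1, h3.2]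

/-- The empirical mean of `p (X m - x)`. -/
def empirical (p : ℝ → ℝ) {n : ℕ} (X : Fin n → ℝ) (x : ℝ) : ℝ := (n : ℝ)⁻¹ * ∑ m, p (X m - x)

/-- The bias `E p (X - x) - f x`. -/
def bias (μ : Measure ℝ) (f p : ℝ → ℝ) (x : ℝ) : ℝ := smooth μ p x - f x

lemma Window.empirical_bddIntegrable (hp : Window p M) {n : ℕ} (X : Fin n → ℝ) :
    BddIntegrable (empirical p X) :=
  (BddIntegrable.sum fun m => hp.bddIntegrable (X m)).const_mul _

lemma Window.bias_bddIntegrable (hp : Window p M) {f : ℝ → ℝ} (hf : BddIntegrable f) :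
    BddIntegrable (bias μ f p) := hp.smooth_bddIntegrable.sub hf

/-- The integrated cross error splits into a degenerate quadratic statistic, two centred linear
statistics and the integrated product of the biases. -/
lemma Window.integral_cross_error_eq (hp : Window p M) (hq : Window q N) {f : ℝ → ℝ}
    (hf : BddIntegrable f) {n : ℕ} (hn : 1 ≤ n) (X : Fin n → ℝ) :
    ∫ x, (empirical p X x - f x) * (empirical q X x - f x)
      = (n : ℝ)⁻¹ ^ 2 * (∑ m, ∑ l, crossKernel μ p q (X m) (X l))
        + (n : ℝ)⁻¹ * (∑ m, ∫ x, centered μ p (X m) x * bias μ f q x)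
        + (n : ℝ)⁻¹ * (∑ m, ∫ x, centered μ q (X m) x * bias μ f p x)
        + ∫ x, bias μ f p x * bias μ f q x := by
  have hn0 : (n : ℝ) ≠ 0 := by positivity
  have hbp := hp.bias_bddIntegrable (μ := μ) hf
  have hbq := hq.bias_bddIntegrable (μ := μ) hf
  have hcp := hp.centered_bddIntegrable (μ := μ)
  have hcq := hq.centered_bddIntegrable (μ := μ)
  have hsplit : ∀ r : ℝ → ℝ, ∀ x, empirical r X x - f x
      = (n : ℝ)⁻¹ * ∑ m, centered μ r (X m) x + bias μ f r x := by
    intro r x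
    simp only [empirical, centered, bias, Finset.sum_sub_distrib, Finset.sum_const,
      Finset.card_univ, Fintype.card_fin, nsmul_eq_mul]
    field_simp
    ring
  have e1 : ∫ x, (∑ m, ∑ l, centered μ p (X m) x * centered μ q (X l) x)
      = ∑ m, ∑ l, crossKernel μ p q (X m) (X l) := by
    rw [integral_finsetSum _ fun m _ => integrable_finsetSum _ fun l _ =>
      (hcp _).integrable_mul (hcq _)]
    refine Finset.sum_congr rfl fun m _ => ?_
    rw [integral_finsetSum _ fun l _ => (hcp _).integrable_mul (hcq _)]
    rfl
  have i1 : Integrable fun x => ∑ m, ∑ l, centered μ p (X m) x * centered μ q (X l) x :=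
    integrable_finsetSum _ fun m _ => integrable_finsetSum _ fun l _ =>
      (hcp _).integrable_mul (hcq _)
  have i2 : Integrable fun x => ∑ m, centered μ p (X m) x * bias μ f q x :=
    integrable_finsetSum _ fun m _ => (hcp _).integrable_mul hbq
  have i3 : Integrable fun x => ∑ m, centered μ q (X m) x * bias μ f p x :=
    integrable_finsetSum _ fun m _ => (hcq _).integrable_mul hbp
  rw [← e1, ← integral_finsetSum _ fun m _ => (hcp _).integrable_mul hbq,
    ← integral_finsetSum _ fun m _ => (hcq _).integrable_mul hbp,
    ← integral_const_mul, ← integral_const_mul, ← integral_const_mul]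
  have j1 := i1.const_mul ((n : ℝ)⁻¹ ^ 2)
  have j2 := i2.const_mul (n : ℝ)⁻¹
  have j3 := i3.const_mul (n : ℝ)⁻¹
  rw [← integral_add j1 j2]
  erw [← integral_add (j1.add j2) j3, ← integral_add ((j1.add j2).add j3) (hbp.integrable_mul hbq)]
  refine integral_congr_ae (.of_forall fun x => ?_)
  simp only [Pi.add_apply]
  rw [hsplit p x, hsplit q x, ← Finset.sum_mul_sum, ← Finset.sum_mul, ← Finset.sum_mul]
  ring

/-- The fluctuation of the integrated cross error around `n⁻¹ ∫ p q + ∫ b_p b_q`, up to the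
deterministic diagonal error. -/
lemma Window.abs_cross_error_sub_le (hp : Window p M) (hq : Window q N) {f : ℝ → ℝ}
    (hf : BddIntegrable f) (hF : 0 ≤ F) (hμ : μ ≤ ENNReal.ofReal F • volume)
    {n : ℕ} (hn : 1 ≤ n) (X : Fin n → ℝ) :
    |(∫ x, (empirical p X x - f x) * (empirical q X x - f x))
      - (n : ℝ)⁻¹ * (∫ u, p u * q u) - ∫ x, bias μ f p x * bias μ f q x|
      ≤ |(n : ℝ)⁻¹ ^ 2 * ∑ a ∈ Finset.univ.offDiag, crossKernel μ p q (X a.1) (X a.2)|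
        + |(n : ℝ)⁻¹ * ∑ m, ∫ x, centered μ p (X m) x * bias μ f q x|
        + |(n : ℝ)⁻¹ * ∑ m, ∫ x, centered μ q (X m) x * bias μ f p x|
        + 2 * F * (n : ℝ)⁻¹ := by
  have hn0 : (n : ℝ) ≠ 0 := by positivity
  rw [hp.integral_cross_error_eq (μ := μ) hq hf hn X]
  have hs : ∑ m, ∑ l, crossKernel μ p q (X m) (X l)
      = (∑ m, crossKernel μ p q (X m) (X m))
        + ∑ a ∈ Finset.univ.offDiag, crossKernel μ p q (X a.1) (X a.2) := by
    rw [← Finset.sum_product', ← Finset.diag_union_offDiag,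
      Finset.sum_union (Finset.disjoint_diag_offDiag _), Finset.sum_diag]
  have hd : |(n : ℝ)⁻¹ ^ 2 * (∑ m, crossKernel μ p q (X m) (X m))
      - (n : ℝ)⁻¹ * ∫ u, p u * q u| ≤ 2 * F * (n : ℝ)⁻¹ := by
    have e : (n : ℝ)⁻¹ ^ 2 * (∑ m, crossKernel μ p q (X m) (X m))
        - (n : ℝ)⁻¹ * ∫ u, p u * q u
        = (n : ℝ)⁻¹ ^ 2 * ∑ m, (crossKernel μ p q (X m) (X m) - ∫ u, p u * q u) := by
      simp only [Finset.sum_sub_distrib, Finset.sum_const, Finset.card_univ, Fintype.card_fin,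
        nsmul_eq_mul]
      field_simp
    rw [e, abs_mul, abs_of_nonneg (by positivity)]
    calc _ ≤ (n : ℝ)⁻¹ ^ 2 * ∑ _m : Fin n, 2 * F := by
          gcongr
          refine (Finset.abs_sum_le_sum_abs _ _).trans (Finset.sum_le_sum fun m _ => ?_)
          exact hp.abs_crossKernel_diag_sub_le hq hF hμ (X m)
      _ = _ := by simp; field_simp
  rw [hs]
  set D := (n : ℝ)⁻¹ ^ 2 * (∑ m, crossKernel μ p q (X m) (X m)) - (n : ℝ)⁻¹ * ∫ u, p u * q u
  set U := (n : ℝ)⁻¹ ^ 2 * ∑ a ∈ Finset.univ.offDiag, crossKernel μ p q (X a.1) (X a.2)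
  set A := (n : ℝ)⁻¹ * ∑ m, ∫ x, centered μ p (X m) x * bias μ f q x
  set B := (n : ℝ)⁻¹ * ∑ m, ∫ x, centered μ q (X m) x * bias μ f p x
  have e : (n : ℝ)⁻¹ ^ 2 * ((∑ m, crossKernel μ p q (X m) (X m))
        + ∑ a ∈ Finset.univ.offDiag, crossKernel μ p q (X a.1) (X a.2)) + A + B
        + (∫ x, bias μ f p x * bias μ f q x) - (n : ℝ)⁻¹ * (∫ u, p u * q u)
        - (∫ x, bias μ f p x * bias μ f q x) = U + A + B + D := by
    simp only [U, D]; ring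
  rw [e]
  calc |U + A + B + D| ≤ |U| + |A| + |B| + |D| :=
        (abs_add_le _ _).trans (add_le_add (abs_add_three _ _ _) le_rfl)
    _ ≤ _ := by gcongr

end Window

/-! ### Square norms, translations and laws with a density -/

lemma enorm_sq_eq_ofReal (a : ℝ) : ‖a‖ₑ ^ 2 = ENNReal.ofReal (a ^ 2) := by
  rw [← ofReal_norm, Real.norm_eq_abs, ← ENNReal.ofReal_pow (abs_nonneg _), sq_abs]

/-- Cauchy–Schwarz against the constant function. -/
lemma enorm_integral_sq_le {α : Type*} [MeasurableSpace α] {ν : Measure α} {g : α → ℝ}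
    (hg : AEMeasurable g ν) : ‖∫ a, g a ∂ν‖ₑ ^ 2 ≤ ν Set.univ * ∫⁻ a, ‖g a‖ₑ ^ 2 ∂ν := by
  have h := ENNReal.lintegral_mul_le_Lp_mul_Lq ν Real.HolderConjugate.two_two
    (f := fun _ => 1) (g := fun a => ‖g a‖ₑ) aemeasurable_const hg.enorm
  simp only [Pi.mul_apply, one_mul, ENNReal.one_rpow, lintegral_const] at h
  have h2 : ‖∫ a, g a ∂ν‖ₑ ≤ _ := (enorm_integral_le_lintegral_enorm g).trans h
  calc ‖∫ a, g a ∂ν‖ₑ ^ 2 ≤ _ := pow_le_pow_left' h2 2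
    _ = _ := by
      rw [mul_pow, ← ENNReal.rpow_natCast, ← ENNReal.rpow_mul, ← ENNReal.rpow_natCast,
        ← ENNReal.rpow_mul]
      norm_num

/-- Minkowski's integral inequality in `L²`, in squared form. -/
lemma lintegral_enorm_integral_sq_le {α β : Type*} [MeasurableSpace α] [MeasurableSpace β]
    {ν : Measure α} [SFinite ν] {m : Measure β} [SFinite m] {φ : β → α → ℝ}
    (hφ : Measurable (Function.uncurry φ)) :
    ∫⁻ x, ‖∫ a, φ x a ∂ν‖ₑ ^ 2 ∂m ≤ ν Set.univ * ∫⁻ a, (∫⁻ x, ‖φ x a‖ₑ ^ 2 ∂m) ∂ν := by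
  have hm : Measurable (Function.uncurry fun x a => ‖φ x a‖ₑ ^ 2) := hφ.enorm.pow_const 2
  calc ∫⁻ x, ‖∫ a, φ x a ∂ν‖ₑ ^ 2 ∂m
      ≤ ∫⁻ x, ν Set.univ * ∫⁻ a, ‖φ x a‖ₑ ^ 2 ∂ν ∂m :=
        lintegral_mono fun x => enorm_integral_sq_le (hφ.comp measurable_prodMk_left).aemeasurable
    _ = ν Set.univ * ∫⁻ x, ∫⁻ a, ‖φ x a‖ₑ ^ 2 ∂ν ∂m :=
        lintegral_const_mul _ hm.lintegral_prod_right'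
    _ = _ := by rw [lintegral_lintegral_swap hm.aemeasurable]

lemma ofReal_integral_sq {v : ℝ → ℝ} (hv : MemLp v 2) :
    ENNReal.ofReal (∫ x, v x ^ 2) = ∫⁻ x, ‖v x‖ₑ ^ 2 := by
  rw [ofReal_integral_eq_lintegral_ofReal hv.integrable_sq (.of_forall fun _ => sq_nonneg _)]
  simp_rw [enorm_sq_eq_ofReal]

lemma BddIntegrable.memLp {v : ℝ → ℝ} (hv : BddIntegrable v) : MemLp v 2 := by
  rw [memLp_two_iff_integrable_sq hv.integrable.aestronglyMeasurable]
  simpa [sq] using hv.integrable_mul hv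

/-- Translation is continuous in `L²`. -/
lemma exists_lintegral_translate_sub_le {g : ℝ → ℝ} (hg : MemLp g 2) {κ : ENNReal} (hκ : κ ≠ 0) :
    ∃ δ > 0, ∀ t : ℝ, |t| < δ → ∫⁻ x, ‖g (x + t) - g x‖ₑ ^ 2 ≤ κ := by
  have : Fact ((2 : ENNReal) ≠ ⊤) := ⟨by norm_num⟩
  have hcont : Continuous fun t : ℝ => DomAddAct.mk t +ᵥ hg.toLp g :=
    (DomAddAct.continuous_mk (M := ℝ)).vadd continuous_const
  have htend := EMetric.tendsto_nhds.1 (hcont.tendsto 0)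
  obtain ⟨η, hη0, hη⟩ : ∃ η : ENNReal, 0 < η ∧ η ^ 2 ≤ κ := by
    refine ⟨κ ^ (1 / 2 : ℝ), ENNReal.rpow_pos_of_nonneg (by positivity) (by norm_num), ?_⟩
    rw [← ENNReal.rpow_natCast, ← ENNReal.rpow_mul]
    norm_num
  obtain ⟨δ, hδ, h⟩ := Metric.eventually_nhds_iff.1 (htend η hη0)
  refine ⟨δ, hδ, fun t ht => ?_⟩
  have h1 := h (y := t) (by simpa using ht)
  have h0 : DomAddAct.mk (0 : ℝ) +ᵥ hg.toLp g = hg.toLp g := zero_vadd _ _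
  rw [h0, DomAddAct.mk_vadd_toLp, Lp.edist_toLp_toLp] at h1
  have h2 : ∫⁻ x, ‖g (x + t) - g x‖ₑ ^ 2
      = eLpNorm ((fun x => g (t +ᵥ x)) - g) 2 volume ^ 2 := by
    have := eLpNorm_nnreal_pow_eq_lintegral (μ := volume) (f := (fun x => g (t +ᵥ x)) - g)
      (p := 2) (by norm_num)
    simp only [NNReal.coe_ofNat, ENNReal.coe_ofNat] at this
    rw [← ENNReal.rpow_natCast, Nat.cast_ofNat, this]
    refine lintegral_congr fun x => ?_
    simp only [Pi.sub_apply, vadd_eq_add, add_comm t x]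
    rw [← ENNReal.rpow_natCast, Nat.cast_ofNat]
  rw [h2]
  exact (pow_le_pow_left' h1.le 2).trans hη

/-- The measure with Lebesgue density `g`. -/
def densityLaw (g : ℝ → ℝ) : Measure ℝ := volume.withDensity fun x => ENNReal.ofReal (g x)

section DensityLaw

variable {g : ℝ → ℝ}

lemma IsDensity.isProbabilityMeasure (hg : IsDensity g) :
    IsProbabilityMeasure (densityLaw g) := by
  refine ⟨?_⟩
  rw [densityLaw, withDensity_apply _ MeasurableSet.univ, Measure.restrict_univ,
    ← ofReal_integral_eq_lintegral_ofReal hg.integrable (.of_forall hg.nonneg),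
    hg.integral_eq_one, ENNReal.ofReal_one]

lemma IsDensity.integral_densityLaw (hg : IsDensity g) (ψ : ℝ → ℝ) :
    ∫ y, ψ y ∂(densityLaw g) = ∫ y, g y * ψ y := by
  rw [densityLaw, integral_withDensity_eq_integral_toReal_smul₀
    hg.integrable.aemeasurable.ennreal_ofReal (by simp)]
  refine integral_congr_ae (.of_forall fun y => ?_)
  simp [ENNReal.toReal_ofReal (hg.nonneg y)]

lemma IsDensity.integrable_densityLaw (hg : IsDensity g) (hm : Measurable g) {ψ : ℝ → ℝ}
    (hψ : Integrable fun y => g y * ψ y) : Integrable ψ (densityLaw g) := by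
  rw [densityLaw, integrable_withDensity_iff_integrable_smul₀' hm.ennreal_ofReal.aemeasurable
    (by simp)]
  refine hψ.congr (.of_forall fun y => ?_)
  simp [ENNReal.toReal_ofReal (hg.nonneg y)]

lemma densityLaw_le {F : ℝ} (hF : ∀ x, g x ≤ F) :
    densityLaw g ≤ ENNReal.ofReal F • volume := by
  rw [← withDensity_const, densityLaw]
  exact withDensity_mono (.of_forall fun x => ENNReal.ofReal_le_ofReal (hF x))

lemma ae_densityLaw_abs_le (hm : Measurable g) {R : ℝ} (hR : ∀ u, R < |u| → g u = 0) :
    ∀ᵐ u ∂(densityLaw g), |u| ≤ R := by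
  rw [densityLaw, ae_withDensity_iff hm.ennreal_ofReal]
  refine .of_forall fun u hu => ?_
  by_contra h
  exact hu (by simp [hR u (not_le.1 h)])

end DensityLaw

/-- The rescaled kernel `u ↦ h⁻¹ K (h⁻¹ u)`. -/
def scaled (K : ℝ → ℝ) (h u : ℝ) : ℝ := h⁻¹ * K (h⁻¹ * u)

lemma integral_scaled (L : ℝ → ℝ) {h : ℝ} (hh : 0 < h) : ∫ u, scaled L h u = ∫ u, L u := by
  unfold scaled
  rw [integral_const_mul, Measure.integral_comp_mul_left, inv_inv, abs_of_pos hh, smul_eq_mul,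
    inv_mul_cancel_left₀ hh.ne']

/-- The expectation of a rescaled kernel, after the change of variables `y = x + h u`. -/
lemma IsDensity.smooth_scaled_eq {f : ℝ → ℝ} (hf : IsDensity f) (L : ℝ → ℝ) {h : ℝ} (hh : 0 < h)
    (x : ℝ) : smooth (densityLaw f) (scaled L h) x = ∫ u, L u * f (x + h * u) := by
  rw [smooth, hf.integral_densityLaw,
    ← integral_add_left_eq_self (fun y => f y * scaled L h (y - x)) x,
    ← integral_scaled (fun u => L u * f (x + h * u)) hh]
  refine integral_congr_ae (.of_forall fun u => ?_)
  simp only [scaled, add_sub_cancel_left, mul_inv_cancel_left₀ hh.ne']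
  ring

lemma IsDensity.scaled {K : ℝ → ℝ} (hK : IsDensity K) {h : ℝ} (hh : 0 < h) :
    IsDensity (scaled K h) where
  nonneg u := mul_nonneg (inv_nonneg.2 hh.le) (hK.nonneg _)
  integrable := (hK.integrable.comp_mul_left' (inv_ne_zero hh.ne')).const_mul _
  integral_eq_one := by rw [integral_scaled K hh, hK.integral_eq_one]

lemma Window.scaled {K : ℝ → ℝ} {M : ℝ} (hK : Window K M) {h : ℝ} (hh : 0 < h) :
    Window (scaled K h) (h⁻¹ * M) where
  density := hK.density.scaled hh
  cont := (hK.cont.comp (continuous_const_mul _)).const_mul _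
  le _ := mul_le_mul_of_nonneg_left (hK.le _) (inv_nonneg.2 hh.le)

lemma estimator_eq_empirical (K : ℝ → ℝ) {n : ℕ} (X : Fin n → ℝ) (h x : ℝ) :
    estimator K X h x = empirical (scaled K h) X x := by
  simp only [estimator, empirical, scaled, ← Finset.mul_sum, mul_inv, mul_assoc]

/-! ### The bias of a kernel estimator -/

section Bias

variable {f K : ℝ → ℝ}

lemma DensityCond.hasDerivAt (hf : DensityCond f) (x : ℝ) : HasDerivAt f (deriv f x) x :=
  (hf.contDiff.differentiable (by norm_num) x).hasDerivAt

lemma DensityCond.hasDerivAt_deriv (hf : DensityCond f) (x : ℝ) :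
    HasDerivAt (deriv f) (iteratedDeriv 2 f x) x := by
  have h := hf.contDiff.differentiable_iteratedDeriv 1 (by norm_num)
  rw [iteratedDeriv_one] at h
  have := (h x).hasDerivAt
  rwa [iteratedDeriv_succ, iteratedDeriv_one]

lemma DensityCond.continuous_deriv (hf : DensityCond f) : Continuous (deriv f) := by
  simpa [iteratedDeriv_one] using hf.contDiff.continuous_iteratedDeriv 1 (by norm_num)

lemma DensityCond.continuous_second (hf : DensityCond f) : Continuous (iteratedDeriv 2 f) :=
  hf.contDiff.continuous_iteratedDeriv 2 le_rfl

lemma DensityCond.exists_bound (hf : DensityCond f) : ∃ F, 0 ≤ F ∧ ∀ x, f x ≤ F := by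
  obtain ⟨C, hC⟩ := hf.bounded 0 (by norm_num)
  simp only [iteratedDeriv_zero] at hC
  exact ⟨C, (abs_nonneg _).trans (hC 0), fun x => (le_abs_self _).trans (hC x)⟩

lemma DensityCond.bddIntegrable (hf : DensityCond f) : BddIntegrable f := by
  obtain ⟨C, hC⟩ := hf.bounded 0 (by norm_num)
  exact ⟨hf.density.integrable, C, by simpa using hC⟩

lemma DensityCond.memLp_second (hf : DensityCond f) : MemLp (iteratedDeriv 2 f) 2 := by
  rw [memLp_two_iff_integrable_sq hf.continuous_second.aestronglyMeasurable]
  exact hf.sq_integrable 2 le_rfl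

lemma DensityCond.memLp_deriv (hf : DensityCond f) : MemLp (deriv f) 2 := by
  rw [memLp_two_iff_integrable_sq hf.continuous_deriv.aestronglyMeasurable]
  simpa [iteratedDeriv_one] using hf.sq_integrable 1 (by norm_num)

/-- The remainder of the second order Taylor expansion of `f` at `x` with increment `v`. -/
def taylorRem (f : ℝ → ℝ) (x v : ℝ) : ℝ :=
  f (x + v) - f x - v * deriv f x - v ^ 2 / 2 * iteratedDeriv 2 f x

lemma DensityCond.taylorRem_eq (hf : DensityCond f) (x v : ℝ) :
    taylorRem f x v = ∫ θ in Set.Ioc (0 : ℝ) 1,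
      v ^ 2 * (1 - θ) * (iteratedDeriv 2 f (x + v * θ) - iteratedDeriv 2 f x) := by
  -- a primitive of the integrand, whose increment over `[0, 1]` is the remainder
  have hd : ∀ θ : ℝ, HasDerivAt (fun θ => f (x + v * θ) + (1 - θ) * v * deriv f (x + v * θ)
      + v ^ 2 / 2 * (1 - θ) ^ 2 * iteratedDeriv 2 f x)
      (v ^ 2 * (1 - θ) * (iteratedDeriv 2 f (x + v * θ) - iteratedDeriv 2 f x)) θ := by
    intro θ
    have h0 : HasDerivAt (fun θ => x + v * θ) v θ := by
      simpa using ((hasDerivAt_id θ).const_mul v).const_add x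
    have h1 := (hf.hasDerivAt (x + v * θ)).comp θ h0
    have h2 := (hf.hasDerivAt_deriv (x + v * θ)).comp θ h0
    have h3 : HasDerivAt (fun θ : ℝ => 1 - θ) (-1) θ := by
      simpa using (hasDerivAt_id θ).const_sub 1
    have h4 := (h1.add ((h3.mul_const v).mul h2)).add
      (((h3.pow 2).const_mul (v ^ 2 / 2)).mul_const (iteratedDeriv 2 f x))
    refine h4.congr_deriv ?_
    simp only [Function.comp]
    push_cast
    ring
  have hcont : Continuous fun θ : ℝ =>
      v ^ 2 * (1 - θ) * (iteratedDeriv 2 f (x + v * θ) - iteratedDeriv 2 f x) := by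
    have := hf.continuous_second
    fun_prop
  rw [← intervalIntegral.integral_of_le zero_le_one,
    intervalIntegral.integral_eq_sub_of_hasDerivAt (fun θ _ => hd θ)
      (hcont.intervalIntegrable _ _), taylorRem]
  simp
  ring

lemma DensityCond.continuous_taylorRem (hf : DensityCond f) :
    Continuous (Function.uncurry (taylorRem f)) := by
  have h0 := hf.contDiff.continuous
  have h1 := hf.continuous_deriv
  have h2 := hf.continuous_second
  unfold taylorRem Function.uncurry
  fun_prop

lemma DensityCond.lintegral_taylorRem_sq_le (hf : DensityCond f) (v : ℝ) {κ : ENNReal}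
    (hκ : ∀ t : ℝ, |t| ≤ |v| →
      ∫⁻ x, ‖iteratedDeriv 2 f (x + t) - iteratedDeriv 2 f x‖ₑ ^ 2 ≤ κ) :
    ∫⁻ x, ‖taylorRem f x v‖ₑ ^ 2 ≤ ENNReal.ofReal (v ^ 4) * κ := by
  have hcont : Continuous (Function.uncurry fun x θ : ℝ =>
      v ^ 2 * (1 - θ) * (iteratedDeriv 2 f (x + v * θ) - iteratedDeriv 2 f x)) := by
    have := hf.continuous_second
    unfold Function.uncurry
    fun_prop
  simp_rw [hf.taylorRem_eq]
  refine (lintegral_enorm_integral_sq_le hcont.measurable).trans ?_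
  have hone : (volume.restrict (Set.Ioc (0 : ℝ) 1)) Set.univ = 1 := by simp
  rw [hone, one_mul]
  calc _ ≤ ∫⁻ _θ in Set.Ioc (0 : ℝ) 1, ENNReal.ofReal (v ^ 4) * κ := by
        refine setLIntegral_mono measurable_const fun θ hθ => ?_
        simp_rw [enorm_mul _ (iteratedDeriv 2 f _ - iteratedDeriv 2 f _), mul_pow]
        rw [lintegral_const_mul' _ _ (by finiteness), enorm_sq_eq_ofReal]
        have hθ' : |v * θ| ≤ |v| := by
          rw [abs_mul, abs_of_pos hθ.1]
          exact mul_le_of_le_one_right (abs_nonneg _) hθ.2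
        refine mul_le_mul' (ENNReal.ofReal_le_ofReal ?_) (hκ _ hθ')
        have : (1 - θ) ^ 2 ≤ 1 := by nlinarith [hθ.1, hθ.2]
        calc (v ^ 2 * (1 - θ)) ^ 2 = v ^ 4 * (1 - θ) ^ 2 := by ring
          _ ≤ v ^ 4 * 1 := by gcongr
          _ = v ^ 4 := mul_one _
    _ = _ := by simp

lemma KernelCond.integral_id (hK : KernelCond K) : ∫ u, u ∂(densityLaw K) = 0 := by
  rw [hK.density.integral_densityLaw]
  have h := integral_neg_eq_self (fun u => K u * u) volume
  simp only [hK.symm, mul_neg, integral_neg] at h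
  linarith

lemma KernelCond.integral_sq (hK : KernelCond K) :
    ∫ u, u ^ 2 ∂(densityLaw K) = secondMoment K := by
  rw [hK.density.integral_densityLaw, secondMoment]
  simp_rw [mul_comm]

lemma KernelCond.secondMoment_nonneg (hK : KernelCond K) : 0 ≤ secondMoment K :=
  integral_nonneg fun u => mul_nonneg (sq_nonneg u) (hK.density.nonneg u)

lemma KernelCond.integrable_sq_law (hK : KernelCond K) (hm : Measurable K) :
    Integrable (fun u => u ^ 2) (densityLaw K) :=
  hK.density.integrable_densityLaw hm (by simpa only [mul_comm] using hK.secondMoment_integrable)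

lemma KernelCond.integrable_id_law (hK : KernelCond K) (hm : Measurable K) :
    Integrable (fun u => u) (densityLaw K) := by
  have := hK.density.isProbabilityMeasure
  refine ((integrable_const 1).add (hK.integrable_sq_law hm)).mono'
    measurable_id.aestronglyMeasurable (.of_forall fun u => ?_)
  simp only [Real.norm_eq_abs, Pi.add_apply]
  nlinarith [sq_abs u, sq_nonneg (|u| - 1), abs_nonneg u]

/-- The symmetry of the kernel cancels the first order term of the bias. -/
lemma bias_sub_eq (hK : KernelCond K) (hm : Measurable K) (hf : DensityCond f) {h : ℝ}
    (hh : 0 < h) (x : ℝ) :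
    bias (densityLaw f) f (scaled K h) x - h ^ 2 / 2 * secondMoment K * iteratedDeriv 2 f x
      = ∫ u, taylorRem f x (h * u) ∂(densityLaw K) := by
  have hP := hK.density.isProbabilityMeasure
  have i0 : Integrable (fun u => f (x + h * u)) (densityLaw K) := by
    obtain ⟨C, hC⟩ := hf.bddIntegrable.bounded
    have hc := hf.contDiff.continuous
    exact .of_bound (by fun_prop) C (.of_forall fun u => hC _)
  have i1 : Integrable (fun u => h * deriv f x * u) (densityLaw K) :=
    (hK.integrable_id_law hm).const_mul _
  have i2 : Integrable (fun u => h ^ 2 / 2 * iteratedDeriv 2 f x * u ^ 2) (densityLaw K) :=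
    (hK.integrable_sq_law hm).const_mul _
  have e : ∀ u, taylorRem f x (h * u) = f (x + h * u) - f x - h * deriv f x * u
      - h ^ 2 / 2 * iteratedDeriv 2 f x * u ^ 2 := fun u => by rw [taylorRem]; ring
  have j0 : Integrable (fun u => f (x + h * u) - f x) (densityLaw K) :=
    i0.sub (integrable_const _)
  have j1 : Integrable (fun u => f (x + h * u) - f x - h * deriv f x * u) (densityLaw K) :=
    j0.sub i1
  simp_rw [e]
  rw [integral_sub j1 i2, integral_sub j0 i1, integral_sub i0 (integrable_const _),
    integral_const_mul, integral_const_mul, hK.integral_id, hK.integral_sq,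
    hK.density.integral_densityLaw, bias, hf.density.smooth_scaled_eq K hh]
  simp
  ring

lemma exists_abs_bias_le (hK : KernelCond K) (hm : Measurable K) (hf : DensityCond f) :
    ∃ C, 0 ≤ C ∧ ∀ h, 0 < h → ∀ x, |bias (densityLaw f) f (scaled K h) x| ≤ C * h ^ 2 := by
  obtain ⟨B, hB⟩ := hf.bounded 2 le_rfl
  have hB0 : 0 ≤ B := (abs_nonneg _).trans (hB 0)
  have hc0 := hK.secondMoment_nonneg
  have hrem : ∀ x v, |taylorRem f x v| ≤ 2 * B * v ^ 2 := by
    intro x v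
    rw [hf.taylorRem_eq]
    have := norm_setIntegral_le_of_norm_le_const (μ := volume) (s := Set.Ioc (0 : ℝ) 1)
      (f := fun θ => v ^ 2 * (1 - θ) * (iteratedDeriv 2 f (x + v * θ) - iteratedDeriv 2 f x))
      (C := 2 * B * v ^ 2) (by simp) (fun θ hθ => by
        rw [Real.norm_eq_abs, abs_mul, abs_mul, abs_of_nonneg (sq_nonneg v),
          abs_of_nonneg (sub_nonneg.2 hθ.2)]
        have h1 : |iteratedDeriv 2 f (x + v * θ) - iteratedDeriv 2 f x| ≤ 2 * B := by
          have := abs_sub (iteratedDeriv 2 f (x + v * θ)) (iteratedDeriv 2 f x)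
          linarith [hB (x + v * θ), hB x]
        calc v ^ 2 * (1 - θ) * |iteratedDeriv 2 f (x + v * θ) - iteratedDeriv 2 f x|
            ≤ v ^ 2 * 1 * (2 * B) := by
              gcongr
              · linarith [hθ.1]
          _ = _ := by ring)
    simpa using this
  refine ⟨2 * B * secondMoment K + secondMoment K / 2 * B, by positivity, fun h hh x => ?_⟩
  have h1 : |∫ u, taylorRem f x (h * u) ∂(densityLaw K)| ≤ 2 * B * secondMoment K * h ^ 2 := by
    have := norm_integral_le_of_norm_le (f := fun u => taylorRem f x (h * u))
      ((hK.integrable_sq_law hm).const_mul (2 * B * h ^ 2)) (.of_forall fun u => by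
        have := hrem x (h * u)
        rw [Real.norm_eq_abs]
        linarith)
    rw [integral_const_mul, hK.integral_sq, Real.norm_eq_abs] at this
    linarith
  rw [← bias_sub_eq hK hm hf hh] at h1
  have h2 : |h ^ 2 / 2 * secondMoment K * iteratedDeriv 2 f x|
      ≤ h ^ 2 / 2 * secondMoment K * B := by
    rw [abs_mul, abs_of_nonneg (by positivity)]
    exact mul_le_mul_of_nonneg_left (hB x) (by positivity)
  have h3 := abs_add_le (bias (densityLaw f) f (scaled K h) x
    - h ^ 2 / 2 * secondMoment K * iteratedDeriv 2 f x)
    (h ^ 2 / 2 * secondMoment K * iteratedDeriv 2 f x)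
  rw [sub_add_cancel] at h3
  linarith

lemma bddIntegrable_bias (hK : KernelCond K) (hc : Continuous K) (hf : DensityCond f) {h : ℝ}
    (hh : 0 < h) : BddIntegrable (bias (densityLaw f) f (scaled K h)) := by
  obtain ⟨M, hM⟩ := hK.bounded
  have := hf.density.isProbabilityMeasure
  have hw : Window K M := ⟨hK.density, hc, fun u => (le_abs_self _).trans (hM u)⟩
  exact (hw.scaled hh).bias_bddIntegrable hf.bddIntegrable

/-- The leading term of the bias in `L²`. -/
lemma exists_integral_bias_sub_sq_le (hK : KernelCond K) (hc : Continuous K)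
    (hsupp : HasCompactSupport K) (hf : DensityCond f) {ε : ℝ} (hε : 0 < ε) :
    ∃ h₀ > 0, ∀ h, 0 < h → h < h₀ →
      ∫ x, (bias (densityLaw f) f (scaled K h) x
        - h ^ 2 / 2 * secondMoment K * iteratedDeriv 2 f x) ^ 2 ≤ ε * h ^ 4 := by
  have hP := hK.density.isProbabilityMeasure
  obtain ⟨R, hR0, hR⟩ : ∃ R > 0, ∀ u, R < |u| → K u = 0 := by
    obtain ⟨R, hR0, hR⟩ := hsupp.isCompact.isBounded.exists_pos_norm_le
    refine ⟨R, hR0, fun u hu => ?_⟩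
    by_contra h
    exact absurd (hR u (subset_tsupport _ h)) (not_le.2 hu)
  have hκ : ENNReal.ofReal (ε / R ^ 4) ≠ 0 := by
    simpa using (by positivity : 0 < ε / R ^ 4)
  obtain ⟨δ, hδ, hδ'⟩ := exists_lintegral_translate_sub_le hf.memLp_second hκ
  refine ⟨δ / R, by positivity, fun h hh hh' => ?_⟩
  have hhR : h * R < δ := (lt_div_iff₀ hR0).1 hh'
  have hmem : MemLp (fun x => bias (densityLaw f) f (scaled K h) x
        - h ^ 2 / 2 * secondMoment K * iteratedDeriv 2 f x) 2 :=
    (bddIntegrable_bias hK hc hf hh).memLp.sub (hf.memLp_second.const_mul _)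
  rw [← ENNReal.ofReal_le_ofReal_iff (by positivity), ofReal_integral_sq hmem]
  simp_rw [bias_sub_eq hK hc.measurable hf hh]
  have hmeas : Measurable (Function.uncurry fun x u => taylorRem f x (h * u)) := by
    have := hf.continuous_taylorRem
    have h2 : Continuous fun w : ℝ × ℝ => (w.1, h * w.2) := by fun_prop
    exact (this.comp h2).measurable
  refine (lintegral_enorm_integral_sq_le hmeas).trans ?_
  rw [measure_univ, one_mul]
  calc _ ≤ ∫⁻ _u, ENNReal.ofReal (ε * h ^ 4) ∂(densityLaw K) := by
        refine lintegral_mono_ae ?_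
        filter_upwards [ae_densityLaw_abs_le hc.measurable hR] with u hu
        have hle : |h * u| ≤ h * R := by
          rw [abs_mul, abs_of_pos hh]
          exact mul_le_mul_of_nonneg_left hu hh.le
        refine (hf.lintegral_taylorRem_sq_le (h * u)
          (fun t ht => hδ' t ((ht.trans hle).trans_lt hhR))).trans ?_
        rw [← ENNReal.ofReal_mul (by positivity)]
        refine ENNReal.ofReal_le_ofReal ?_
        have h4 : (h * u) ^ 4 ≤ (h * R) ^ 4 := by
          rw [← (by decide : Even 4).pow_abs (h * u)]
          gcongr
        calc (h * u) ^ 4 * (ε / R ^ 4) ≤ (h * R) ^ 4 * (ε / R ^ 4) := by gcongr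
          _ = _ := by field_simp
    _ = _ := by simp

/-- Cauchy–Schwarz in the weighted arithmetic–geometric form. -/
lemma abs_integral_mul_le {v w : ℝ → ℝ} (hv : MemLp v 2) (hw : MemLp w 2) {η : ℝ} (hη : 0 < η) :
    |∫ x, v x * w x| ≤ η / 2 * (∫ x, v x ^ 2) + 1 / (2 * η) * ∫ x, w x ^ 2 := by
  rw [← integral_const_mul, ← integral_const_mul,
    ← integral_add (hv.integrable_sq.const_mul _) (hw.integrable_sq.const_mul _)]
  refine norm_integral_le_of_norm_le (f := fun x => v x * w x)
    ((hv.integrable_sq.const_mul _).add (hw.integrable_sq.const_mul _)) (.of_forall fun x => ?_)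
  rw [Real.norm_eq_abs, abs_mul]
  have h1 : η / 2 * v x ^ 2 + 1 / (2 * η) * w x ^ 2 - |v x| * |w x|
      = (η * |v x| - |w x|) ^ 2 / (2 * η) := by
    rw [← sq_abs (v x), ← sq_abs (w x)]
    field_simp
    ring
  have h2 : 0 ≤ (η * |v x| - |w x|) ^ 2 / (2 * η) := by positivity
  linarith

/-- The leading term of the integrated product of two biases. -/
lemma exists_abs_integral_bias_mul_sub_le (hK : KernelCond K) (hc : Continuous K)
    (hsupp : HasCompactSupport K) (hf : DensityCond f) {ε : ℝ} (hε : 0 < ε) :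
    ∃ h₀ > 0, ∀ h k, 0 < h → h < h₀ → 0 < k → k < h₀ →
      |(∫ x, bias (densityLaw f) f (scaled K h) x * bias (densityLaw f) f (scaled K k) x)
        - curvature f * (1 / 4 * h ^ 2 * k ^ 2 * secondMoment K ^ 2)| ≤ ε * (h ^ 2 * k ^ 2) := by
  set c := secondMoment K with hcdef
  set γ := curvature f with hγ
  have hγ0 : 0 ≤ γ := integral_nonneg fun x => sq_nonneg _
  have hc0 : 0 ≤ c := hK.secondMoment_nonneg
  -- with `b_h = h² (β + ρ_h)`, `β = c f'' / 2` and `‖ρ_h‖² ≤ κ`, the error is at most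
  -- `η ‖β‖² + κ / η + κ`
  set S := c ^ 2 / 4 * γ with hS
  have hS0 : 0 ≤ S := by positivity
  obtain ⟨η, hη0, hη⟩ : ∃ η > 0, η * S ≤ ε / 3 :=
    ⟨ε / 3 / (S + 1), by positivity, by
      rw [div_mul_eq_mul_div, div_le_iff₀ (by positivity)]
      nlinarith⟩
  set κ := min (η * (ε / 3)) (ε / 3) with hκ
  have hκ0 : 0 < κ := by positivity
  obtain ⟨h₀, hh₀, H⟩ := exists_integral_bias_sub_sq_le hK hc hsupp hf hκ0
  refine ⟨h₀, hh₀, fun h k hh hh' hk hk' => ?_⟩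
  let β : ℝ → ℝ := fun x => c / 2 * iteratedDeriv 2 f x
  let ρ : ℝ → ℝ → ℝ := fun h x => (h ^ 2)⁻¹ * (bias (densityLaw f) f (scaled K h) x
        - h ^ 2 / 2 * c * iteratedDeriv 2 f x)
  have hβ : MemLp β 2 := hf.memLp_second.const_mul _
  have hρ : ∀ h, 0 < h → MemLp (ρ h) 2 := fun h hh =>
    ((bddIntegrable_bias hK hc hf hh).memLp.sub (hf.memLp_second.const_mul _)).const_mul _
  have hρle : ∀ h, 0 < h → h < h₀ → ∫ x, ρ h x ^ 2 ≤ κ := by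
    intro h hh hh'
    simp only [ρ, mul_pow]
    rw [integral_const_mul]
    calc _ ≤ ((h ^ 2)⁻¹) ^ 2 * (κ * h ^ 4) := by
          gcongr
          exact H h hh hh'
      _ = κ := by field_simp
  have hβS : ∫ x, β x ^ 2 = S := by
    simp only [β, mul_pow]
    rw [integral_const_mul, hS, hγ, curvature]
    ring
  have hb : ∀ h, 0 < h → ∀ x, bias (densityLaw f) f (scaled K h) x = h ^ 2 * (β x + ρ h x) := by
    intro h hh x
    simp only [β, ρ]
    field_simp
    ring
  have i1 := hβ.integrable_sq
  have i2 : Integrable fun x => β x * ρ k x := hβ.integrable_mul (hρ k hk)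
  have i3 : Integrable fun x => β x * ρ h x := hβ.integrable_mul (hρ h hh)
  have i4 : Integrable fun x => ρ h x * ρ k x := (hρ h hh).integrable_mul (hρ k hk)
  have j1 : Integrable fun x => β x ^ 2 + β x * ρ k x := i1.add i2
  have j2 : Integrable fun x => β x ^ 2 + β x * ρ k x + β x * ρ h x := j1.add i3
  have e : ∫ x, bias (densityLaw f) f (scaled K h) x * bias (densityLaw f) f (scaled K k) x
      = h ^ 2 * k ^ 2 * (S + (∫ x, β x * ρ k x) + (∫ x, β x * ρ h x) + ∫ x, ρ h x * ρ k x) := by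
    rw [← hβS, ← integral_add i1 i2, ← integral_add j1 i3, ← integral_add j2 i4,
      ← integral_const_mul]
    refine integral_congr_ae (.of_forall fun x => ?_)
    simp only [hb h hh, hb k hk]
    ring
  have b2 := abs_integral_mul_le hβ (hρ k hk) hη0
  have b3 := abs_integral_mul_le hβ (hρ h hh) hη0
  have b4 := abs_integral_mul_le (hρ h hh) (hρ k hk) one_pos
  have r1 := hρle h hh hh'
  have r2 := hρle k hk hk'
  have hκ1 : 1 / (2 * η) * κ ≤ ε / 6 := by
    calc 1 / (2 * η) * κ ≤ 1 / (2 * η) * (η * (ε / 3)) := by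
          gcongr
          exact min_le_left _ _
      _ = ε / 6 := by field_simp; ring
  have hκ2 : κ ≤ ε / 3 := min_le_right _ _
  have r1' : 1 / (2 * η) * ∫ x, ρ h x ^ 2 ≤ ε / 6 :=
    (mul_le_mul_of_nonneg_left r1 (by positivity)).trans hκ1
  have r2' : 1 / (2 * η) * ∫ x, ρ k x ^ 2 ≤ ε / 6 :=
    (mul_le_mul_of_nonneg_left r2 (by positivity)).trans hκ1
  rw [hβS] at b2 b3
  have e2 : (∫ x, bias (densityLaw f) f (scaled K h) x * bias (densityLaw f) f (scaled K k) x)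
        - γ * (1 / 4 * h ^ 2 * k ^ 2 * c ^ 2)
      = h ^ 2 * k ^ 2 * ((∫ x, β x * ρ k x) + (∫ x, β x * ρ h x) + ∫ x, ρ h x * ρ k x) := by
    rw [e, hS]
    ring
  rw [e2, abs_mul, abs_of_nonneg (by positivity), mul_comm]
  gcongr
  refine (abs_add_three _ _ _).trans ?_
  linarith

end Bias

/-! ### Replacing a random bandwidth by a deterministic one -/

/-- The kernel `(u K(u))'`, which governs the derivative of a kernel estimator with respect to its
bandwidth. -/
def bandwidthKernel (K : ℝ → ℝ) (u : ℝ) : ℝ := K u + u * deriv K u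

section Bandwidth

variable {K f : ℝ → ℝ}

lemma continuous_bandwidthKernel (hK : ContDiff ℝ 2 K) : Continuous (bandwidthKernel K) := by
  have h0 := hK.continuous
  have h1 : Continuous (deriv K) := hK.continuous_deriv (by norm_num)
  unfold bandwidthKernel
  fun_prop

lemma hasCompactSupport_bandwidthKernel (hs : HasCompactSupport K) :
    HasCompactSupport (bandwidthKernel K) :=
  hs.add (hs.deriv.mul_left (f := fun u => u))

lemma hasDerivAt_mul_kernel (hK : ContDiff ℝ 2 K) (u : ℝ) :
    HasDerivAt (fun u => u * K u) (bandwidthKernel K u) u := by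
  have h := (hasDerivAt_id u).mul (hK.differentiable (by norm_num) u).hasDerivAt
  refine h.congr_deriv ?_
  simp [bandwidthKernel]

lemma hasDerivAt_scaled (hK : ContDiff ℝ 2 K) (v : ℝ) {s : ℝ} (hs : 0 < s) :
    HasDerivAt (fun s => scaled K s v) (-(s⁻¹ * scaled (bandwidthKernel K) s v)) s := by
  have h1 : HasDerivAt (fun s : ℝ => s⁻¹ * v) (-(s ^ 2)⁻¹ * v) s :=
    (hasDerivAt_inv hs.ne').mul_const v
  have h2 := (hasDerivAt_inv hs.ne').mul
    ((hK.differentiable (by norm_num) (s⁻¹ * v)).hasDerivAt.comp s h1)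
  refine h2.congr_deriv ?_
  simp only [scaled, bandwidthKernel, Function.comp]
  field_simp
  ring

lemma continuousOn_scaled {L : ℝ → ℝ} (hL : Continuous L) (v : ℝ) :
    ContinuousOn (fun s => scaled L s v) (Set.Ioi 0) := by
  have : ContinuousOn (fun s : ℝ => s⁻¹) (Set.Ioi 0) :=
    continuousOn_inv₀.mono fun s hs => (ne_of_gt hs)
  unfold scaled
  fun_prop

lemma measurable_scaled {L : ℝ → ℝ} (hL : Continuous L) :
    Measurable (Function.uncurry (scaled L)) := by
  have := hL.measurable
  unfold scaled Function.uncurry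
  fun_prop

lemma measurable_empirical_scaled {L : ℝ → ℝ} (hL : Continuous L) {n : ℕ} :
    Measurable fun w : (Fin n → ℝ) × ℝ × ℝ => empirical (scaled L w.2.1) w.1 w.2.2 := by
  unfold empirical
  refine Measurable.const_mul (Finset.measurable_sum _ fun m _ => ?_) _
  have e : Measurable fun w : (Fin n → ℝ) × ℝ × ℝ => (w.2.1, w.1 m - w.2.2) := by fun_prop
  exact (measurable_scaled hL).comp e

/-- The fundamental theorem of calculus in the bandwidth. -/
lemma empirical_scaled_sub (hK : ContDiff ℝ 2 K) {n : ℕ} (X : Fin n → ℝ) {h k : ℝ} (hh : 0 < h)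
    (hk : 0 < k) (x : ℝ) :
    empirical (scaled K h) X x - empirical (scaled K k) X x
      = ∫ s in k..h, -(s⁻¹ * empirical (scaled (bandwidthKernel K) s) X x) := by
  have hpos : ∀ s ∈ Set.uIcc k h, 0 < s := fun s hs => (lt_min hk hh).trans_le hs.1
  symm
  refine intervalIntegral.integral_eq_sub_of_hasDerivAt
    (f := fun s => empirical (scaled K s) X x) (fun s hs => ?_) ?_
  · have := (HasDerivAt.fun_sum (u := Finset.univ) fun m _ =>
      hasDerivAt_scaled hK (X m - x) (hpos s hs)).const_mul (n : ℝ)⁻¹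
    refine this.congr_deriv ?_
    simp only [empirical, Finset.sum_neg_distrib, ← Finset.mul_sum]
    ring
  · refine ContinuousOn.intervalIntegrable ?_
    have h1 : ContinuousOn (fun s : ℝ => s⁻¹) (Set.uIcc k h) :=
      continuousOn_inv₀.mono fun s hs => (hpos s hs).ne'
    have h2 : ∀ m, ContinuousOn (fun s => scaled (bandwidthKernel K) s (X m - x))
        (Set.uIcc k h) := fun m =>
      (continuousOn_scaled (continuous_bandwidthKernel hK) _).mono fun s hs => hpos s hs
    unfold empirical
    exact (h1.mul (continuousOn_const.mul (continuousOn_finsetSum _ fun m _ => h2 m))).neg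

/-- A bound, measurable in the sample, for the integrated squared change of the estimator when the
bandwidth moves by at most `δ` away from `k`, in any manner depending on the sample. -/
def bandwidthMajorant (K : ℝ → ℝ) (k δ : ℝ) {n : ℕ} (X : Fin n → ℝ) : ENNReal :=
  ENNReal.ofReal (2 * δ) * ∫⁻ s in Set.Icc (k - δ) (k + δ),
    (∫⁻ x, ‖s⁻¹ * empirical (scaled (bandwidthKernel K) s) X x‖ₑ ^ 2)

lemma lintegral_empirical_sub_sq_le (hK : ContDiff ℝ 2 K) {n : ℕ} (X : Fin n → ℝ) {h k δ : ℝ}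
    (hh : 0 < h) (hk : 0 < k) (hδ : |h - k| ≤ δ) :
    ∫⁻ x, ‖empirical (scaled K h) X x - empirical (scaled K k) X x‖ₑ ^ 2
      ≤ bandwidthMajorant K k δ X := by
  have hsub : Set.uIoc k h ⊆ Set.Icc (k - δ) (k + δ) := by
    intro s hs
    rw [abs_le] at hδ
    rcases Set.mem_uIoc.1 hs with h1 | h1 <;> constructor <;> linarith [h1.1, h1.2]
  have hmeas : Measurable (Function.uncurry fun x s : ℝ =>
      -(s⁻¹ * empirical (scaled (bandwidthKernel K) s) X x)) := by
    have e : Measurable fun w : ℝ × ℝ => (X, w.2, w.1) := by fun_prop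
    have := (measurable_empirical_scaled (n := n) (continuous_bandwidthKernel hK)).comp e
    exact (measurable_snd.inv.mul this).neg
  have e : ∀ x, ‖empirical (scaled K h) X x - empirical (scaled K k) X x‖ₑ
      = ‖∫ s in Set.uIoc k h, -(s⁻¹ * empirical (scaled (bandwidthKernel K) s) X x)‖ₑ := by
    intro x
    rw [empirical_scaled_sub hK X hh hk x, ← ofReal_norm, ← ofReal_norm,
      intervalIntegral.norm_intervalIntegral_eq]
  simp_rw [e]
  refine (lintegral_enorm_integral_sq_le hmeas).trans ?_
  simp_rw [enorm_neg]
  refine mul_le_mul' ?_ (lintegral_mono_set hsub)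
  rw [Measure.restrict_apply_univ]
  refine (measure_mono hsub).trans ?_
  rw [Real.volume_Icc]
  exact ENNReal.ofReal_le_ofReal (by linarith)

/-- The mean of the bandwidth derivative is small, because `bandwidthKernel K` is the derivative
of `u K(u)`: integrating by parts moves the derivative onto the density. -/
lemma smooth_bandwidthKernel_eq (hK : KernelCond K) (hKs : HasCompactSupport K)
    (hK2 : ContDiff ℝ 2 K) (hf : DensityCond f) {s : ℝ} (hs : 0 < s) (x : ℝ) :
    smooth (densityLaw f) (scaled (bandwidthKernel K) s) x
      = ∫ u, -(s * (u * deriv f (x + s * u))) ∂(densityLaw K) := by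
  rw [hf.density.smooth_scaled_eq _ hs, hK.density.integral_densityLaw]
  have hu : ∀ u, HasDerivAt (fun u => f (x + s * u)) (s * deriv f (x + s * u)) u := by
    intro u
    have h0 : HasDerivAt (fun u => x + s * u) s u := by
      simpa using ((hasDerivAt_id u).const_mul s).const_add x
    have := (hf.hasDerivAt (x + s * u)).comp u h0
    rwa [mul_comm] at this
  have hcf := hf.contDiff.continuous
  have hcf1 := hf.continuous_deriv
  have hcK := hK2.continuous
  have hcL := continuous_bandwidthKernel hK2
  have hsv : HasCompactSupport fun u => u * K u := hKs.mul_left (f := fun u => u)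
  have h := integral_mul_deriv_eq_deriv_mul_of_integrable
    (u := fun u => f (x + s * u)) (u' := fun u => s * deriv f (x + s * u))
    (v := fun u => u * K u) (v' := bandwidthKernel K)
    (fun u _ => hu u) (fun u _ => hasDerivAt_mul_kernel hK2 u)
    (Continuous.integrable_of_hasCompactSupport (by fun_prop)
      (hasCompactSupport_bandwidthKernel hKs).mul_left)
    (Continuous.integrable_of_hasCompactSupport (by fun_prop) hsv.mul_left)
    (Continuous.integrable_of_hasCompactSupport (by fun_prop) hsv.mul_left)
  calc _ = ∫ u, f (x + s * u) * bandwidthKernel K u :=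
        integral_congr_ae (.of_forall fun u => mul_comm _ _)
    _ = _ := h
    _ = _ := by
        rw [← integral_neg]
        refine integral_congr_ae (.of_forall fun u => ?_)
        simp only
        ring

lemma lintegral_smooth_bandwidthKernel_sq_le (hK : KernelCond K) (hKs : HasCompactSupport K)
    (hK2 : ContDiff ℝ 2 K) (hf : DensityCond f) {s : ℝ} (hs : 0 < s) :
    ∫⁻ x, ‖smooth (densityLaw f) (scaled (bandwidthKernel K) s) x‖ₑ ^ 2
      ≤ ENNReal.ofReal (s ^ 2 * (secondMoment K * ∫ x, deriv f x ^ 2)) := by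
  have hP := hK.density.isProbabilityMeasure
  have hcf1 := hf.continuous_deriv
  have hc : Continuous (Function.uncurry fun x u : ℝ => -(s * (u * deriv f (x + s * u)))) := by
    unfold Function.uncurry
    fun_prop
  simp_rw [smooth_bandwidthKernel_eq hK hKs hK2 hf hs]
  refine (lintegral_enorm_integral_sq_le hc.measurable).trans ?_
  rw [measure_univ, one_mul]
  have e : ∀ u, ∫⁻ x, ‖-(s * (u * deriv f (x + s * u)))‖ₑ ^ 2
      = ENNReal.ofReal (s ^ 2 * (∫ x, deriv f x ^ 2) * u ^ 2) := by
    intro u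
    have : ∀ x, ‖-(s * (u * deriv f (x + s * u)))‖ₑ ^ 2
        = ENNReal.ofReal ((s * u) ^ 2) * ‖deriv f (x + s * u)‖ₑ ^ 2 := by
      intro x
      rw [enorm_neg, ← mul_assoc, enorm_mul, mul_pow, enorm_sq_eq_ofReal (s * u)]
    simp_rw [this]
    rw [lintegral_const_mul' _ _ (by finiteness),
      lintegral_add_right_eq_self (fun x => ‖deriv f x‖ₑ ^ 2), ← ofReal_integral_sq hf.memLp_deriv,
      ← ENNReal.ofReal_mul (by positivity)]
    congr 1
    ring
  simp_rw [e]
  rw [← ofReal_integral_eq_lintegral_ofReal ((hK.integrable_sq_law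
    hK2.continuous.measurable).const_mul _) (.of_forall fun u => ?_), integral_const_mul,
    hK.integral_sq]
  · exact le_of_eq (by congr 1; ring)
  · have : 0 ≤ ∫ x, deriv f x ^ 2 := integral_nonneg fun _ => sq_nonneg _
    simp only [Pi.zero_apply]
    positivity

variable {Ω : Type*} [MeasurableSpace Ω] {P : Measure Ω} [IsProbabilityMeasure P]

/-- The integrated second moment of a kernel statistic is controlled by variance and squared
mean. -/
lemma lintegral_empirical_sq_le {μ : Measure ℝ} [IsProbabilityMeasure μ] {n : ℕ} (hn : 1 ≤ n)
    {X : Fin n → Ω → ℝ} (hXm : ∀ i, Measurable (X i)) (hind : iIndepFun X P)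
    (hlaw : ∀ i, P.map (X i) = μ) {p : ℝ → ℝ} (hp : Continuous p) {C : ℝ} (hC : ∀ u, |p u| ≤ C) :
    ∫⁻ x, (∫⁻ ω, ‖empirical p (fun m => X m ω) x‖ₑ ^ 2 ∂P)
      ≤ ENNReal.ofReal (2 * (n : ℝ)⁻¹) * (∫⁻ u, ‖p u‖ₑ ^ 2)
        + 2 * ∫⁻ x, ‖smooth μ p x‖ₑ ^ 2 := by
  have hpt : ∀ x, ∫⁻ ω, ‖empirical p (fun m => X m ω) x‖ₑ ^ 2 ∂P
      ≤ ENNReal.ofReal (2 * (n : ℝ)⁻¹) * (∫⁻ y, ‖p (y - x)‖ₑ ^ 2 ∂μ)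
        + 2 * ‖smooth μ p x‖ₑ ^ 2 := by
    intro x
    have hpx : Measurable fun y => p (y - x) := by
      have := hp.measurable
      fun_prop
    have hem : Measurable fun ω => empirical p (fun m => X m ω) x := by
      unfold empirical
      exact Measurable.const_mul (Finset.measurable_sum _ fun m _ => hpx.comp (hXm m)) _
    have hbd : ∀ ω, |empirical p (fun m => X m ω) x| ≤ C := by
      intro ω
      have hn0 : (n : ℝ) ≠ 0 := by positivity
      rw [empirical, abs_mul, abs_of_nonneg (by positivity)]
      calc _ ≤ (n : ℝ)⁻¹ * ∑ _m : Fin n, C := by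
            gcongr
            exact (Finset.abs_sum_le_sum_abs _ _).trans (Finset.sum_le_sum fun m _ => hC _)
        _ = C := by simp [hn0]
    have hi1 : Integrable (fun ω => (empirical p (fun m => X m ω) x - smooth μ p x) ^ 2) P :=
      .of_bound ((hem.sub_const _).pow_const 2).aestronglyMeasurable
        ((C + |smooth μ p x|) ^ 2) (.of_forall fun ω => by
          rw [Real.norm_eq_abs, abs_pow]
          have := abs_sub (empirical p (fun m => X m ω) x) (smooth μ p x)
          have := hbd ω
          gcongr
          linarith)
    have hvar := integral_empirical_sq_le (P := P) hXm hind hlaw hpx (fun y => hC (y - x)) hn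
    have hsq : ∫⁻ y, ‖p (y - x)‖ₑ ^ 2 ∂μ = ENNReal.ofReal (∫ y, p (y - x) ^ 2 ∂μ) := by
      rw [ofReal_integral_eq_lintegral_ofReal _ (.of_forall fun _ => sq_nonneg _)]
      · simp_rw [enorm_sq_eq_ofReal]
      · exact .of_bound (hpx.pow_const 2).aestronglyMeasurable (C ^ 2) (.of_forall fun y => by
          rw [Real.norm_eq_abs, abs_pow]
          exact pow_le_pow_left₀ (abs_nonneg _) (hC _) 2)
    calc ∫⁻ ω, ‖empirical p (fun m => X m ω) x‖ₑ ^ 2 ∂P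
        ≤ ∫⁻ ω, ENNReal.ofReal (2 * (empirical p (fun m => X m ω) x - smooth μ p x) ^ 2
            + 2 * smooth μ p x ^ 2) ∂P := by
          refine lintegral_mono fun ω => ?_
          rw [enorm_sq_eq_ofReal]
          refine ENNReal.ofReal_le_ofReal ?_
          nlinarith [sq_nonneg (empirical p (fun m => X m ω) x - 2 * smooth μ p x)]
      _ = ENNReal.ofReal (∫ ω, (2 * (empirical p (fun m => X m ω) x - smooth μ p x) ^ 2
            + 2 * smooth μ p x ^ 2) ∂P) := by
          have hi2 : Integrable (fun ω => 2 * (empirical p (fun m => X m ω) x - smooth μ p x) ^ 2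
              + 2 * smooth μ p x ^ 2) P := (hi1.const_mul 2).add (integrable_const _)
          rw [ofReal_integral_eq_lintegral_ofReal hi2
            (.of_forall fun ω => by simp only [Pi.zero_apply]; positivity)]
      _ ≤ ENNReal.ofReal (2 * (n : ℝ)⁻¹ * (∫ y, p (y - x) ^ 2 ∂μ) + 2 * smooth μ p x ^ 2) := by
          refine ENNReal.ofReal_le_ofReal ?_
          rw [integral_add (hi1.const_mul 2) (integrable_const _), integral_const_mul]
          simp only [integral_const, probReal_univ, one_smul]
          have : ∫ ω, (empirical p (fun m => X m ω) x - smooth μ p x) ^ 2 ∂P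
              ≤ (n : ℝ)⁻¹ * ∫ y, p (y - x) ^ 2 ∂μ := hvar
          linarith
      _ = _ := by
          rw [ENNReal.ofReal_add (by positivity) (by positivity),
            ENNReal.ofReal_mul (by positivity), hsq,
            ENNReal.ofReal_mul (by norm_num), enorm_sq_eq_ofReal]
          simp
  have hm : Measurable (Function.uncurry fun x y : ℝ => ‖p (y - x)‖ₑ ^ 2) := by
    have : Continuous fun w : ℝ × ℝ => p (w.2 - w.1) := by fun_prop
    exact this.measurable.enorm.pow_const 2
  have hm' : Measurable fun x => ∫⁻ y, ‖p (y - x)‖ₑ ^ 2 ∂μ := hm.lintegral_prod_right'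
  refine (lintegral_mono hpt).trans ?_
  rw [lintegral_add_left (hm'.const_mul _), lintegral_const_mul _ hm',
    lintegral_lintegral_swap hm.aemeasurable,
    lintegral_const_mul _ ((measurable_smooth hp.measurable).enorm.pow_const 2)]
  have : ∀ y, ∫⁻ x, ‖p (y - x)‖ₑ ^ 2 = ∫⁻ u, ‖p u‖ₑ ^ 2 := fun y =>
    lintegral_sub_left_eq_self (fun u => ‖p u‖ₑ ^ 2) y
  simp [this]

lemma measurable_bandwidthMajorant (hK : ContDiff ℝ 2 K) (k δ : ℝ) {n : ℕ} :
    Measurable (bandwidthMajorant K k δ (n := n)) := by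
  have h := measurable_empirical_scaled (n := n) (continuous_bandwidthKernel hK)
  have e : Measurable fun w : ((Fin n → ℝ) × ℝ) × ℝ => (w.1.1, w.1.2, w.2) := by fun_prop
  have e2 : Measurable fun w : ((Fin n → ℝ) × ℝ) × ℝ => w.1.2⁻¹ := by fun_prop
  have h1 : Measurable fun w : ((Fin n → ℝ) × ℝ) × ℝ =>
      ‖w.1.2⁻¹ * empirical (scaled (bandwidthKernel K) w.1.2) w.1.1 w.2‖ₑ ^ 2 :=
    (e2.mul (h.comp e)).enorm.pow_const 2
  have h2 : Measurable fun w : (Fin n → ℝ) × ℝ =>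
      ∫⁻ x, ‖w.2⁻¹ * empirical (scaled (bandwidthKernel K) w.2) w.1 x‖ₑ ^ 2 :=
    h1.lintegral_prod_right'
  exact (h2.lintegral_prod_right' (ν := volume.restrict (Set.Icc (k - δ) (k + δ)))).const_mul _

/-- The majorant of the bandwidth change is of order `δ²` in mean as long as `n k³` stays away
from zero. -/
lemma exists_lintegral_bandwidthMajorant_le (hK : KernelCond K) (hKs : HasCompactSupport K)
    (hK2 : ContDiff ℝ 2 K) (hf : DensityCond f) :
    ∃ C, 0 ≤ C ∧ ∀ n : ℕ, 1 ≤ n → ∀ X : Fin n → Ω → ℝ, (∀ i, Measurable (X i)) →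
      iIndepFun X P → (∀ i, P.map (X i) = densityLaw f) → ∀ k δ : ℝ, 0 < k → 0 ≤ δ → δ ≤ k / 2 →
        ∫⁻ ω, bandwidthMajorant K k δ (fun m => X m ω) ∂P
          ≤ ENNReal.ofReal (C * δ ^ 2 * (((n : ℝ) * k ^ 3)⁻¹ + 1)) := by
  have hPf := hf.density.isProbabilityMeasure
  set L := bandwidthKernel K with hLdef
  have hcL : Continuous L := continuous_bandwidthKernel hK2
  have hsL : HasCompactSupport L := hasCompactSupport_bandwidthKernel hKs
  obtain ⟨B, hB⟩ := hsL.exists_bound_of_continuous hcL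
  have hB' : ∀ u, |L u| ≤ B := hB
  set S := ∫ u, L u ^ 2 with hS
  have hS0 : 0 ≤ S := integral_nonneg fun _ => sq_nonneg _
  set D := secondMoment K * ∫ x, deriv f x ^ 2 with hD
  have hD0 : 0 ≤ D := mul_nonneg hK.secondMoment_nonneg (integral_nonneg fun _ => sq_nonneg _)
  have hL2 : Integrable fun u => L u ^ 2 := by
    have : HasCompactSupport fun u => L u ^ 2 := by
      simp_rw [sq]
      exact hsL.mul_left
    exact Continuous.integrable_of_hasCompactSupport (by fun_prop) this
  refine ⟨4 * (16 * S + 2 * D), by positivity, fun n hn X hXm hind hlaw k δ hk hδ0 hδ => ?_⟩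
  have hn0 : (0 : ℝ) < n := by positivity
  have hbd : ∀ s ∈ Set.Icc (k - δ) (k + δ),
      ∫⁻ x, (∫⁻ ω, ‖s⁻¹ * empirical (scaled L s) (fun m => X m ω) x‖ₑ ^ 2 ∂P)
        ≤ ENNReal.ofReal (16 * S * ((n : ℝ) * k ^ 3)⁻¹ + 2 * D) := by
    intro s hs
    have hsk : k / 2 ≤ s := by linarith [hs.1]
    have hs0 : 0 < s := by linarith
    have hsc : Continuous (scaled L s) := by
      unfold scaled
      fun_prop
    have h1 := lintegral_empirical_sq_le (P := P) hn hXm hind hlaw hsc (C := s⁻¹ * B) (fun u => by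
      rw [scaled, abs_mul, abs_of_nonneg (inv_nonneg.2 hs0.le)]
      exact mul_le_mul_of_nonneg_left (hB' _) (inv_nonneg.2 hs0.le))
    have h2 := lintegral_smooth_bandwidthKernel_sq_le hK hKs hK2 hf hs0
    have h3 : ∫⁻ u, ‖scaled L s u‖ₑ ^ 2 = ENNReal.ofReal (s⁻¹ * S) := by
      rw [hS, ← integral_scaled (fun u => L u ^ 2) hs0, ← integral_const_mul,
        ofReal_integral_eq_lintegral_ofReal]
      · refine lintegral_congr fun u => ?_
        rw [enorm_sq_eq_ofReal]
        congr 1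
        simp only [scaled]
        ring
      · exact ((hL2.comp_mul_left' (inv_ne_zero hs0.ne')).const_mul _).const_mul _
      · refine .of_forall fun u => ?_
        simp only [scaled, Pi.zero_apply]
        positivity
    calc ∫⁻ x, (∫⁻ ω, ‖s⁻¹ * empirical (scaled L s) (fun m => X m ω) x‖ₑ ^ 2 ∂P)
        = ENNReal.ofReal ((s⁻¹) ^ 2)
          * ∫⁻ x, (∫⁻ ω, ‖empirical (scaled L s) (fun m => X m ω) x‖ₑ ^ 2 ∂P) := by
          simp_rw [enorm_mul, mul_pow, enorm_sq_eq_ofReal (s⁻¹)]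
          rw [← lintegral_const_mul' _ _ (by finiteness)]
          refine lintegral_congr fun x => ?_
          rw [lintegral_const_mul' _ _ (by finiteness)]
      _ ≤ ENNReal.ofReal ((s⁻¹) ^ 2) * (ENNReal.ofReal (2 * (n : ℝ)⁻¹) * ENNReal.ofReal (s⁻¹ * S)
          + 2 * ENNReal.ofReal (s ^ 2 * D)) := by
          rw [h3] at h1
          gcongr
          exact h1.trans (by gcongr)
      _ = ENNReal.ofReal ((s⁻¹) ^ 2 * (2 * (n : ℝ)⁻¹ * (s⁻¹ * S) + 2 * (s ^ 2 * D))) := by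
          rw [ENNReal.ofReal_mul (p := (s⁻¹) ^ 2) (by positivity),
            ENNReal.ofReal_add (by positivity) (by positivity),
            ENNReal.ofReal_mul (p := 2 * (n : ℝ)⁻¹) (by positivity),
            ENNReal.ofReal_mul (p := 2) (q := s ^ 2 * D) (by positivity)]
          simp
      _ ≤ _ := by
          refine ENNReal.ofReal_le_ofReal ?_
          have e1 : (s⁻¹) ^ 2 * (2 * (n : ℝ)⁻¹ * (s⁻¹ * S) + 2 * (s ^ 2 * D))
              = 2 * S * ((n : ℝ)⁻¹ * (s⁻¹) ^ 3) + 2 * D := by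
            field_simp
          have e2 : (s⁻¹) ^ 3 ≤ 8 * (k ^ 3)⁻¹ := by
            calc (s⁻¹) ^ 3 ≤ ((k / 2)⁻¹) ^ 3 := by gcongr
              _ = _ := by field_simp; norm_num
          rw [e1]
          calc _ ≤ 2 * S * ((n : ℝ)⁻¹ * (8 * (k ^ 3)⁻¹)) + 2 * D := by gcongr
            _ = _ := by rw [mul_inv]; ring
  have hmX : Measurable fun ω => (fun m => X m ω) := measurable_pi_lambda _ hXm
  have hm0 := measurable_empirical_scaled (n := n) hcL
  have hm : Measurable fun w : (Ω × ℝ) × ℝ =>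
      ‖w.1.2⁻¹ * empirical (scaled L w.1.2) (fun m => X m w.1.1) w.2‖ₑ ^ 2 := by
    have e : Measurable fun w : (Ω × ℝ) × ℝ => ((fun m => X m w.1.1), w.1.2, w.2) :=
      (hmX.comp (measurable_fst.comp measurable_fst)).prodMk (by fun_prop)
    have e2 : Measurable fun w : (Ω × ℝ) × ℝ => w.1.2⁻¹ := by fun_prop
    exact (e2.mul (hm0.comp e)).enorm.pow_const 2
  have hm1 : Measurable fun w : Ω × ℝ =>
      ∫⁻ x, ‖w.2⁻¹ * empirical (scaled L w.2) (fun m => X m w.1) x‖ₑ ^ 2 :=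
    hm.lintegral_prod_right'
  calc ∫⁻ ω, bandwidthMajorant K k δ (fun m => X m ω) ∂P
      = ENNReal.ofReal (2 * δ) * ∫⁻ s in Set.Icc (k - δ) (k + δ), ∫⁻ x,
          (∫⁻ ω, ‖s⁻¹ * empirical (scaled L s) (fun m => X m ω) x‖ₑ ^ 2 ∂P) := by
        simp only [bandwidthMajorant]
        rw [lintegral_const_mul' _ _ (by finiteness), lintegral_lintegral_swap hm1.aemeasurable]
        congr 1
        refine lintegral_congr fun s => ?_
        rw [lintegral_lintegral_swap]
        have e : Measurable fun w : Ω × ℝ => ((w.1, s), w.2) := by fun_prop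
        exact (hm.comp e).aemeasurable
    _ ≤ ENNReal.ofReal (2 * δ) * ∫⁻ _s in Set.Icc (k - δ) (k + δ),
          ENNReal.ofReal (16 * S * ((n : ℝ) * k ^ 3)⁻¹ + 2 * D) := by
        exact mul_le_mul_right (setLIntegral_mono measurable_const hbd) _
    _ = ENNReal.ofReal (2 * δ * ((16 * S * ((n : ℝ) * k ^ 3)⁻¹ + 2 * D) * (2 * δ))) := by
        rw [setLIntegral_const, Real.volume_Icc, ← ENNReal.ofReal_mul (by positivity),
          ← ENNReal.ofReal_mul (by positivity)]
        congr 3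
        ring
    _ ≤ _ := by
        refine ENNReal.ofReal_le_ofReal ?_
        have : 0 ≤ ((n : ℝ) * k ^ 3)⁻¹ := by positivity
        nlinarith [mul_nonneg (mul_nonneg hD0 this) (sq_nonneg δ), mul_nonneg hS0 (sq_nonneg δ)]

/-- Rescaled kernels are Lipschitz in the bandwidth, uniformly in space. -/
lemma exists_abs_scaled_sub_le (hKs : HasCompactSupport K) (hK2 : ContDiff ℝ 2 K) :
    ∃ C, 0 ≤ C ∧ ∀ h k : ℝ, 0 < k → |h - k| ≤ k / 2 → ∀ u,
      |scaled K h u - scaled K k u| ≤ C * (|h - k| * (k ^ 2)⁻¹) := by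
  obtain ⟨B, hB⟩ := (hasCompactSupport_bandwidthKernel hKs).exists_bound_of_continuous
    (continuous_bandwidthKernel hK2)
  have hB0 : 0 ≤ B := (norm_nonneg _).trans (hB 0)
  refine ⟨4 * B, by positivity, fun h k hk hhk u => ?_⟩
  have hIcc : ∀ s ∈ Set.Icc (k / 2) (3 * k / 2), 0 < s := fun s hs => by linarith [hs.1]
  have := (convex_Icc (k / 2) (3 * k / 2)).norm_image_sub_le_of_norm_hasDerivWithin_le
    (f := fun s => scaled K s u) (C := 4 * B * (k ^ 2)⁻¹) (x := k) (y := h)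
    (fun s hs => (hasDerivAt_scaled hK2 u (hIcc s hs)).hasDerivWithinAt) (fun s hs => ?_)
    ⟨by linarith, by linarith⟩ ⟨by linarith [(abs_le.1 hhk).1], by linarith [(abs_le.1 hhk).2]⟩
  · simp only [Real.norm_eq_abs] at this
    linarith
  · have hs0 := hIcc s hs
    rw [norm_neg, scaled, norm_mul, norm_mul, Real.norm_of_nonneg (inv_nonneg.2 hs0.le)]
    have h1 : s⁻¹ ≤ 2 * k⁻¹ := by
      calc s⁻¹ ≤ (k / 2)⁻¹ := by gcongr; exact hs.1
        _ = _ := by field_simp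
    calc s⁻¹ * (s⁻¹ * ‖bandwidthKernel K (s⁻¹ * u)‖) ≤ 2 * k⁻¹ * (2 * k⁻¹ * B) := by
          gcongr
          exact hB _
      _ = _ := by field_simp; ring

end Bandwidth

open Filter Topology

/-! ### Calculus of `o_p` -/

section LittleOp

variable {Ω : Type*} [MeasurableSpace Ω] {P : Measure Ω} [IsProbabilityMeasure P]
  {Y Z : ℕ → Ω → ℝ} {r : ℕ → ℝ}

lemma isLittleOp_iff (hr : ∀ᶠ n in atTop, 0 < r n) :
    IsLittleOp P Y r ↔ ∀ ε > 0, ∀ κ > 0, ∀ᶠ n in atTop, P.real {ω | ε * r n ≤ |Y n ω|} ≤ κ := by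
  rw [IsLittleOp, tendstoInMeasure_iff_measureReal_norm]
  have hset : ∀ ε, ∀ᶠ n in atTop,
      {ω | ε ≤ ‖Y n ω / r n - 0‖} = {ω | ε * r n ≤ |Y n ω|} := by
    intro ε
    filter_upwards [hr] with n hn
    ext ω
    simp only [Set.mem_ofPred_eq, sub_zero, norm_div, Real.norm_eq_abs, abs_of_pos hn]
    rw [le_div_iff₀ hn]
  refine forall₂_congr fun ε hε => ?_
  rw [tendsto_congr' ((hset ε).mono fun n hn => by rw [hn])]
  constructor
  · intro h κ hκ
    exact (h.eventually (gt_mem_nhds hκ)).mono fun n hn => hn.le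
  · intro h
    refine tendsto_order.2 ⟨fun a ha => .of_forall fun n => ha.trans_le measureReal_nonneg,
      fun a ha => ?_⟩
    filter_upwards [h (a / 2) (by positivity)] with n hn
    linarith

/-- To be `o_p(r)` it suffices to be within `η r` of some `o_p(r)` sequence, for every `η`. -/
lemma IsLittleOp.of_approx (hr : ∀ᶠ n in atTop, 0 < r n)
    (h : ∀ η > 0, ∃ Z : ℕ → Ω → ℝ, IsLittleOp P Z r ∧
      ∀ᶠ n in atTop, ∀ᵐ ω ∂P, |Y n ω| ≤ η * r n + |Z n ω|) : IsLittleOp P Y r := by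
  rw [isLittleOp_iff hr]
  intro ε hε κ hκ
  obtain ⟨Z, hZ, hle⟩ := h (ε / 2) (by positivity)
  filter_upwards [(isLittleOp_iff hr).1 hZ (ε / 2) (by positivity) κ hκ, hle] with n hn hn2
  refine le_trans ?_ hn
  refine ENNReal.toReal_mono (measure_ne_top _ _) (measure_mono_ae ?_)
  filter_upwards [hn2] with ω hω hω2
  change ε / 2 * r n ≤ |Z n ω|
  have : ε * r n ≤ |Y n ω| := hω2
  linarith

lemma IsLittleOp.add (hr : ∀ᶠ n in atTop, 0 < r n) (hY : IsLittleOp P Y r)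
    (hZ : IsLittleOp P Z r) : IsLittleOp P (fun n ω => Y n ω + Z n ω) r := by
  rw [isLittleOp_iff hr] at *
  intro ε hε κ hκ
  filter_upwards [hY (ε / 2) (by positivity) (κ / 2) (by positivity),
    hZ (ε / 2) (by positivity) (κ / 2) (by positivity)] with n h1 h2
  have hsub : {ω | ε * r n ≤ |Y n ω + Z n ω|}
      ⊆ {ω | ε / 2 * r n ≤ |Y n ω|} ∪ {ω | ε / 2 * r n ≤ |Z n ω|} := by
    intro ω hω
    by_contra hcon
    simp only [Set.mem_union, Set.mem_ofPred_eq, not_or, not_le] at hcon hω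
    have := abs_add_le (Y n ω) (Z n ω)
    linarith [hcon.1, hcon.2]
  calc _ ≤ _ := measureReal_mono hsub
    _ ≤ _ := measureReal_union_le _ _
    _ ≤ κ := by linarith

lemma IsLittleOp.const_mul (hr : ∀ᶠ n in atTop, 0 < r n) (hY : IsLittleOp P Y r) (a : ℝ) :
    IsLittleOp P (fun n ω => a * Y n ω) r := by
  rw [isLittleOp_iff hr] at *
  intro ε hε κ hκ
  filter_upwards [hY (ε / (|a| + 1)) (by positivity) κ hκ, hr] with n hn hrn
  refine le_trans (measureReal_mono fun ω hω => ?_) hn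
  simp only [Set.mem_ofPred_eq, abs_mul] at hω ⊢
  rw [div_mul_eq_mul_div, div_le_iff₀ (by positivity)]
  nlinarith [abs_nonneg a, abs_nonneg (Y n ω)]

/-- Chebyshev's inequality as an `o_p` statement. -/
lemma IsLittleOp.of_sq (hr : ∀ᶠ n in atTop, 0 < r n) {a : ℕ → ℝ} (ha : Tendsto a atTop (𝓝 0))
    (hint : ∀ᶠ n in atTop, Integrable (fun ω => Y n ω ^ 2) P)
    (h : ∀ᶠ n in atTop, ∫ ω, Y n ω ^ 2 ∂P ≤ a n * r n ^ 2) : IsLittleOp P Y r := by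
  rw [isLittleOp_iff hr]
  intro ε hε κ hκ
  have hκ' : 0 < κ * ε ^ 2 := by positivity
  filter_upwards [hr, hint, h, ha.eventually (gt_mem_nhds hκ')] with n hrn hi hle han
  have hset : {ω | ε * r n ≤ |Y n ω|} ⊆ {ω | (ε * r n) ^ 2 ≤ Y n ω ^ 2} := by
    intro ω hω
    simp only [Set.mem_ofPred_eq] at hω ⊢
    rw [← sq_abs (Y n ω)]
    exact pow_le_pow_left₀ (by positivity) hω 2
  have hm := mul_meas_ge_le_integral_of_nonneg (.of_forall fun ω => sq_nonneg (Y n ω)) hi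
    ((ε * r n) ^ 2)
  refine (measureReal_mono hset).trans ?_
  have h1 : (ε * r n) ^ 2 * P.real {ω | (ε * r n) ^ 2 ≤ Y n ω ^ 2} ≤ (ε * r n) ^ 2 * κ := by
    calc _ ≤ _ := hm
      _ ≤ a n * r n ^ 2 := hle
      _ ≤ κ * ε ^ 2 * r n ^ 2 := by gcongr
      _ = _ := by ring
  exact le_of_mul_le_mul_left h1 (by positivity)

/-- A sequence that is small whenever two `o_p(s)` sequences are at most `s`. -/
lemma IsLittleOp.of_close (hr : ∀ᶠ n in atTop, 0 < r n) {s : ℕ → ℝ}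
    (hs : ∀ᶠ n in atTop, 0 < s n) {U V : ℕ → Ω → ℝ} (hU : IsLittleOp P U s)
    (hV : IsLittleOp P V s)
    (h : ∀ ε > 0, ∀ᶠ n in atTop, ∀ᵐ ω ∂P, |U n ω| ≤ s n → |V n ω| ≤ s n → |Y n ω| ≤ ε * r n) :
    IsLittleOp P Y r := by
  rw [isLittleOp_iff hr]
  rw [isLittleOp_iff hs] at hU hV
  intro ε hε κ hκ
  filter_upwards [hU 1 one_pos (κ / 2) (by positivity), hV 1 one_pos (κ / 2) (by positivity),
    h (ε / 2) (by positivity), hr] with n h1 h2 h3 hrn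
  have hsub : {ω | ε * r n ≤ |Y n ω|}
      ≤ᵐ[P] ({ω | 1 * s n ≤ |U n ω|} ∪ {ω | 1 * s n ≤ |V n ω|} : Set Ω) := by
    filter_upwards [h3] with ω hω hωY
    by_contra hcon
    have hcon' : ¬ (1 * s n ≤ |U n ω| ∨ 1 * s n ≤ |V n ω|) := hcon
    simp only [one_mul, not_or, not_le] at hcon'
    have h4 := hω hcon'.1.le hcon'.2.le
    have h5 : ε * r n ≤ |Y n ω| := hωY
    nlinarith
  calc _ ≤ _ := ENNReal.toReal_mono (measure_ne_top _ _) (measure_mono_ae hsub)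
    _ ≤ _ := measureReal_union_le _ _
    _ ≤ κ := by linarith

end LittleOp

/-! ### The optimal rate -/

/-- The rate `n ^ (-1/5)` of the optimal bandwidth. -/
def rate (n : ℕ) : ℝ := (n : ℝ) ^ (-(1 / 5) : ℝ)

lemma rate_pow (n m : ℕ) : rate n ^ m = (n : ℝ) ^ (-(1 / 5) * m : ℝ) := by
  rw [rate, ← Real.rpow_natCast, ← Real.rpow_mul (Nat.cast_nonneg n)]

lemma rate_pow_five (n : ℕ) : rate n ^ 5 = (n : ℝ)⁻¹ := by
  rw [rate_pow, ← Real.rpow_neg_one]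
  norm_num

lemma rate_pos : ∀ᶠ n in atTop, 0 < rate n := by
  filter_upwards [eventually_ge_atTop 1] with n hn
  exact Real.rpow_pos_of_pos (by exact_mod_cast hn) _

lemma rate_pow_pos (m : ℕ) : ∀ᶠ n in atTop, 0 < rate n ^ m :=
  rate_pos.mono fun n hn => by positivity

lemma tendsto_rate : Tendsto rate atTop (𝓝 0) :=
  (tendsto_rpow_neg_atTop (by norm_num : (0 : ℝ) < 1 / 5)).comp tendsto_natCast_atTop_atTop

lemma eventually_const_mul_rate_le (C : ℝ) {ε : ℝ} (hε : 0 < ε) :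
    ∀ᶠ n in atTop, C * rate n ≤ ε := by
  have : Tendsto (fun n => C * rate n) atTop (𝓝 0) := by simpa using tendsto_rate.const_mul C
  exact (this.eventually (gt_mem_nhds hε)).mono fun n hn => hn.le

/-- A deterministic bandwidth sequence of exact order `n ^ (-1/5)`, with explicit constants. -/
structure HasRate (h : ℕ → ℝ) (c C : ℝ) : Prop where
  pos : 0 < c
  bounds : ∀ᶠ n in atTop, c * rate n ≤ h n ∧ h n ≤ C * rate n

lemma exists_hasRate {h : ℕ → ℝ} (h0 : ∀ n, 1 ≤ n → 0 < h n)
    (hΘ : Asymptotics.IsTheta atTop h (fun n => (n : ℝ) ^ (-(1 / 5) : ℝ))) :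
    ∃ c C, 0 < C ∧ HasRate h c C := by
  obtain ⟨C, hC0, hC⟩ := hΘ.1.exists_pos
  obtain ⟨c, hc0, hc⟩ := hΘ.2.exists_pos
  refine ⟨c⁻¹, C, hC0, inv_pos.2 hc0, ?_⟩
  filter_upwards [hC.bound, hc.bound, eventually_ge_atTop 1, rate_pos] with n h1 h2 hn hr
  rw [← rate, Real.norm_of_nonneg (h0 n hn).le, Real.norm_of_nonneg hr.le] at h1 h2
  refine ⟨?_, h1⟩
  rw [inv_mul_le_iff₀ hc0]
  exact h2

/-! ### The expansion of the Gram matrix -/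

/-- The integrated cross error of the estimators with bandwidths `h` and `k`. -/
def crossError (K f : ℝ → ℝ) {n : ℕ} (X : Fin n → ℝ) (h k : ℝ) : ℝ :=
  ∫ x, (empirical (scaled K h) X x - f x) * (empirical (scaled K k) X x - f x)

/-- The integrated squared difference of the estimators with bandwidths `h` and `k`. -/
def sqDiff (K : ℝ → ℝ) {n : ℕ} (X : Fin n → ℝ) (h k : ℝ) : ℝ :=
  ∫ x, (empirical (scaled K h) X x - empirical (scaled K k) X x) ^ 2

/-- The variance part `n⁻¹ ∫ K_h K_k`. -/
def varTerm (K : ℝ → ℝ) (n : ℕ) (h k : ℝ) : ℝ := (n : ℝ)⁻¹ * ∫ u, scaled K h u * scaled K k u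

/-- The squared bias part, without the curvature factor. -/
def biasTerm (K : ℝ → ℝ) (h k : ℝ) : ℝ := 1 / 4 * h ^ 2 * k ^ 2 * secondMoment K ^ 2

section Expansion

variable {Ω : Type*} [MeasurableSpace Ω] {P : Measure Ω} [IsProbabilityMeasure P]
  {K f : ℝ → ℝ} {X : ℕ → Ω → ℝ}

lemma KernelCond.exists_window (hK : KernelCond K) (hc : Continuous K) : ∃ M, Window K M := by
  obtain ⟨M, hM⟩ := hK.bounded
  exact ⟨M, hK.density, hc, fun u => (le_abs_self _).trans (hM u)⟩

lemma Window.scaled_bddIntegrable {M : ℝ} (hw : Window K M) {h : ℝ} (hh : 0 < h) :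
    BddIntegrable (KDE.scaled K h) :=
  ⟨(hw.scaled hh).density.integrable, h⁻¹ * M, fun u => by
    rw [abs_of_nonneg ((hw.scaled hh).density.nonneg u)]; exact (hw.scaled hh).le u⟩

lemma HasRate.eventually_pos {h : ℕ → ℝ} {c C : ℝ} (hh : HasRate h c C) :
    ∀ᶠ n in atTop, 0 < h n := by
  filter_upwards [hh.bounds, rate_pos] with n hn hr
  exact (mul_pos hh.pos hr).trans_le hn.1

lemma HasRate.eventually_lt {h : ℕ → ℝ} {c C : ℝ} (hh : HasRate h c C) {ε : ℝ} (hε : 0 < ε) :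
    ∀ᶠ n in atTop, h n < ε := by
  filter_upwards [hh.bounds, eventually_const_mul_rate_le C (half_pos hε)] with n hn hr
  linarith [hn.2]

/-- The linear statistics in the cross error are negligible. -/
lemma isLittleOp_linear (hK : KernelCond K) (hc : Continuous K) (hf : DensityCond f)
    (hXm : ∀ m, Measurable (X m)) (hind : iIndepFun X P) (hlaw : ∀ m, P.map (X m) = densityLaw f)
    {h k : ℕ → ℝ} {c C c' C' : ℝ} (hh : HasRate h c C) (hk : HasRate k c' C') :
    IsLittleOp P (fun n ω => (n : ℝ)⁻¹ * ∑ m : Fin n,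
      ∫ x, centered (densityLaw f) (scaled K (h n)) (X m ω) x
        * bias (densityLaw f) f (scaled K (k n)) x) (fun n => rate n ^ 4) := by
  have hPf := hf.density.isProbabilityMeasure
  obtain ⟨M, hw⟩ := hK.exists_window hc
  obtain ⟨B, hB0, hB⟩ := exists_abs_bias_le hK hc.measurable hf
  set ψ : ℕ → ℝ → ℝ := fun n y => ∫ x, centered (densityLaw f) (scaled K (h n)) y x
        * bias (densityLaw f) f (scaled K (k n)) x with hψ
  have hψm : ∀ᶠ n in atTop, Measurable (ψ n) := by
    filter_upwards [hh.eventually_pos, hk.eventually_pos] with n h1 h2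
    exact measurable_integral_centered_mul (hw.scaled h1).cont.measurable
      ((measurable_smooth (hw.scaled h2).cont.measurable).sub hf.contDiff.continuous.measurable)
  have hψb : ∀ᶠ n in atTop, ∀ y, |ψ n y| ≤ 2 * (B * k n ^ 2) := by
    filter_upwards [hh.eventually_pos, hk.eventually_pos] with n h1 h2 y
    exact (hw.scaled h1).abs_integral_centered_mul_le (fun x => hB _ h2 x) y
  have hψ0 : ∀ᶠ n in atTop, ∫ y, ψ n y ∂(densityLaw f) = 0 := by
    filter_upwards [hh.eventually_pos, hk.eventually_pos] with n h1 h2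
    exact (hw.scaled h1).integral_integral_centered_mul
      ((hw.scaled h2).bias_bddIntegrable hf.bddIntegrable).integrable
  refine IsLittleOp.of_sq (rate_pow_pos 4)
    (a := fun n => 4 * B ^ 2 * C' ^ 4 * rate n) (by simpa using tendsto_rate.const_mul _) ?_ ?_
  · filter_upwards [hψm, hψb] with n h1 h2
    have hm₀ : ∀ m : Fin n, Measurable fun ω => ψ n (X m ω) := fun m => h1.comp (hXm m)
    have hm : Measurable fun ω => (n : ℝ)⁻¹ * ∑ m : Fin n, ψ n (X m ω) :=
      (Finset.measurable_sum _ fun m _ => hm₀ m).const_mul _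
    change Integrable (fun ω => ((n : ℝ)⁻¹ * ∑ m : Fin n, ψ n (X m ω)) ^ 2) P
    refine .of_bound (hm.pow_const 2).aestronglyMeasurable
      (((n : ℝ)⁻¹ * ∑ _m : Fin n, 2 * (B * k n ^ 2)) ^ 2) (.of_forall fun ω => ?_)
    rw [Real.norm_eq_abs, abs_pow, abs_mul, abs_of_nonneg (by positivity)]
    gcongr
    exact (Finset.abs_sum_le_sum_abs _ _).trans (Finset.sum_le_sum fun m _ => h2 _)
  · filter_upwards [hψm, hψb, hψ0, hk.bounds, hk.eventually_pos, eventually_ge_atTop 1, rate_pos]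
      with n h1 h2 h3 h4 h5 hn hr
    have hv := integral_empirical_sq_le (P := P) (X := fun m : Fin n => X m) (fun m => hXm m)
      (hind.precomp Fin.val_injective) (fun m => hlaw m) h1 h2 hn
    simp only [h3, sub_zero] at hv
    have h6 : ∫ y, ψ n y ^ 2 ∂(densityLaw f) ≤ (2 * (B * k n ^ 2)) ^ 2 := by
      have := integral_mono_of_nonneg (μ := densityLaw f) (.of_forall fun y => sq_nonneg (ψ n y))
        (integrable_const ((2 * (B * k n ^ 2)) ^ 2)) (.of_forall fun y => by
          simp only
          rw [← sq_abs (ψ n y)]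
          exact pow_le_pow_left₀ (abs_nonneg _) (h2 y) 2)
      simpa using this
    have h7 : k n ^ 4 ≤ (C' * rate n) ^ 4 := pow_le_pow_left₀ h5.le h4.2 4
    calc _ ≤ _ := hv
      _ ≤ (n : ℝ)⁻¹ * (2 * (B * k n ^ 2)) ^ 2 := by gcongr
      _ = rate n ^ 5 * (4 * B ^ 2 * k n ^ 4) := by rw [rate_pow_five]; ring
      _ ≤ rate n ^ 5 * (4 * B ^ 2 * (C' * rate n) ^ 4) := by gcongr
      _ = _ := by ring

/-- The degenerate quadratic statistic in the cross error is negligible. -/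
lemma isLittleOp_quadratic (hK : KernelCond K) (hc : Continuous K) (hf : DensityCond f)
    (hXm : ∀ m, Measurable (X m)) (hind : iIndepFun X P) (hlaw : ∀ m, P.map (X m) = densityLaw f)
    {h k : ℕ → ℝ} {c C c' C' : ℝ} (hh : HasRate h c C) (hk : HasRate k c' C') :
    IsLittleOp P (fun n ω => (n : ℝ)⁻¹ ^ 2 * ∑ a ∈ (Finset.univ : Finset (Fin n)).offDiag,
      crossKernel (densityLaw f) (scaled K (h n)) (scaled K (k n)) (X a.1 ω) (X a.2 ω))
      (fun n => rate n ^ 4) := by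
  have hPf := hf.density.isProbabilityMeasure
  obtain ⟨M, hw⟩ := hK.exists_window hc
  obtain ⟨F, hF0, hF⟩ := hf.exists_bound
  have hM0 := hw.bound_nonneg
  set H : ℕ → ℝ → ℝ → ℝ := fun n =>
    crossKernel (densityLaw f) (scaled K (h n)) (scaled K (k n)) with hH
  have hHm : ∀ᶠ n in atTop, Measurable (Function.uncurry (H n)) := by
    filter_upwards [hh.eventually_pos, hk.eventually_pos] with n h1 h2
    exact measurable_crossKernel (hw.scaled h1).cont.measurable (hw.scaled h2).cont.measurable
  have hHb : ∀ᶠ n in atTop, ∀ y z, |H n y z| ≤ 2 * ((k n)⁻¹ * M) := by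
    filter_upwards [hh.eventually_pos, hk.eventually_pos] with n h1 h2 y z
    exact (hw.scaled h1).abs_crossKernel_le (hw.scaled h2) y z
  refine IsLittleOp.of_sq (rate_pow_pos 4)
    (a := fun n => 16 * c'⁻¹ * M * F * rate n) (by simpa using tendsto_rate.const_mul _) ?_ ?_
  · filter_upwards [hHm, hHb] with n h1 h2
    have hm₀ : ∀ a : Fin n × Fin n, Measurable fun ω => H n (X a.1 ω) (X a.2 ω) := fun a =>
      h1.comp ((hXm a.1).prodMk (hXm a.2))
    have hm : Measurable fun ω => (n : ℝ)⁻¹ ^ 2 *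
        ∑ a ∈ (Finset.univ : Finset (Fin n)).offDiag, H n (X a.1 ω) (X a.2 ω) :=
      (Finset.measurable_sum _ fun a _ => hm₀ a).const_mul _
    change Integrable (fun ω => ((n : ℝ)⁻¹ ^ 2 *
        ∑ a ∈ (Finset.univ : Finset (Fin n)).offDiag, H n (X a.1 ω) (X a.2 ω)) ^ 2) P
    refine .of_bound (hm.pow_const 2).aestronglyMeasurable
      (((n : ℝ)⁻¹ ^ 2 * ∑ _a ∈ (Finset.univ : Finset (Fin n)).offDiag,
        2 * ((k n)⁻¹ * M)) ^ 2) (.of_forall fun ω => ?_)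
    rw [Real.norm_eq_abs, abs_pow, abs_mul, abs_of_nonneg (a := (n : ℝ)⁻¹ ^ 2) (by positivity)]
    gcongr
    exact (Finset.abs_sum_le_sum_abs _ _).trans (Finset.sum_le_sum fun a _ => h2 _ _)
  · filter_upwards [hHm, hHb, hh.eventually_pos, hk.bounds, hk.eventually_pos,
      eventually_ge_atTop 1, rate_pos] with n h1 h2 h3 h4 h5 hn hr
    have hn0 : (n : ℝ) ≠ 0 := by positivity
    have hv := integral_degenerate_sq_le (P := P) (X := fun m : Fin n => X m) (fun m => hXm m)
      (hind.precomp Fin.val_injective) (fun m => hlaw m) h1 h2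
      (fun z => (hw.scaled h3).integral_crossKernel_left (hw.scaled h5) z)
      (fun y => (hw.scaled h3).integral_crossKernel_right (hw.scaled h5) y)
    have h6 := (hw.scaled h3).integral_crossKernel_sq_le (hw.scaled h5) hF0 (densityLaw_le hF)
    have h7 : (k n)⁻¹ ≤ c'⁻¹ * (rate n)⁻¹ := by
      rw [← mul_inv]
      exact inv_anti₀ (mul_pos hk.pos hr) h4.1
    simp_rw [mul_pow ((n : ℝ)⁻¹ ^ 2)]
    rw [integral_const_mul]
    rw [Fintype.card_fin] at hv
    calc _ ≤ ((n : ℝ)⁻¹ ^ 2) ^ 2 * (2 * (n : ℝ) ^ 2 * (8 * ((k n)⁻¹ * M) * F)) := by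
          gcongr
          refine hv.trans ?_
          gcongr
      _ = ((n : ℝ)⁻¹) ^ 2 * (16 * (k n)⁻¹ * M * F) := by field_simp; ring
      _ ≤ ((n : ℝ)⁻¹) ^ 2 * (16 * (c'⁻¹ * (rate n)⁻¹) * M * F) := by gcongr
      _ = _ := by
          rw [← rate_pow_five]
          field_simp

/-- The expansion of the integrated cross error for deterministic bandwidths. -/
lemma isLittleOp_crossError_deterministic (hK : KernelCond K) (hc : Continuous K)
    (hsupp : HasCompactSupport K) (hf : DensityCond f)
    (hXm : ∀ m, Measurable (X m)) (hind : iIndepFun X P) (hlaw : ∀ m, P.map (X m) = densityLaw f)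
    {h k : ℕ → ℝ} {c C c' C' : ℝ} (hh : HasRate h c C) (hk : HasRate k c' C') :
    IsLittleOp P (fun n ω => crossError K f (fun m : Fin n => X m ω) (h n) (k n)
      - (varTerm K n (h n) (k n) + curvature f * biasTerm K (h n) (k n)))
      (fun n => rate n ^ 4) := by
  have hPf := hf.density.isProbabilityMeasure
  obtain ⟨M, hw⟩ := hK.exists_window hc
  obtain ⟨F, hF0, hF⟩ := hf.exists_bound
  have hU := isLittleOp_quadratic hK hc hf hXm hind hlaw hh hk
  have hA := isLittleOp_linear hK hc hf hXm hind hlaw hh hk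
  have hB := isLittleOp_linear hK hc hf hXm hind hlaw hk hh
  rw [isLittleOp_iff (rate_pow_pos 4)] at hU hA hB
  have hrest : ∀ ε > 0, ∀ᶠ n : ℕ in atTop, 2 * F * (n : ℝ)⁻¹
      + |(∫ x, bias (densityLaw f) f (scaled K (h n)) x * bias (densityLaw f) f (scaled K (k n)) x)
        - curvature f * biasTerm K (h n) (k n)| ≤ ε * rate n ^ 4 := by
    intro ε hε
    obtain ⟨h₀, hh₀, H⟩ := exists_abs_integral_bias_mul_sub_le hK hc hsupp hf
      (ε := ε / 2 / (C ^ 2 * C' ^ 2 + 1)) (by positivity)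
    filter_upwards [hh.bounds, hk.bounds, hh.eventually_pos, hk.eventually_pos,
      hh.eventually_lt hh₀, hk.eventually_lt hh₀, rate_pos,
      eventually_const_mul_rate_le (2 * F) (half_pos hε)] with n b1 b2 p1 p2 l1 l2 hr hFr
    have h1 := H (h n) (k n) p1 l1 p2 l2
    have h2 : h n ^ 2 * k n ^ 2 ≤ (C * rate n) ^ 2 * (C' * rate n) ^ 2 :=
      mul_le_mul (pow_le_pow_left₀ p1.le b1.2 2) (pow_le_pow_left₀ p2.le b2.2 2)
        (by positivity) (by positivity)
    have h3 : ε / 2 / (C ^ 2 * C' ^ 2 + 1) * (h n ^ 2 * k n ^ 2) ≤ ε / 2 * rate n ^ 4 := by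
      rw [div_mul_eq_mul_div, div_le_iff₀ (by positivity)]
      have : h n ^ 2 * k n ^ 2 ≤ rate n ^ 4 * (C ^ 2 * C' ^ 2 + 1) := by
        refine h2.trans ?_
        have : (C * rate n) ^ 2 * (C' * rate n) ^ 2 = rate n ^ 4 * (C ^ 2 * C' ^ 2) := by ring
        rw [this]
        gcongr
        linarith
      calc _ ≤ ε / 2 * (rate n ^ 4 * (C ^ 2 * C' ^ 2 + 1)) := by gcongr
        _ = _ := by ring
    have h4 : 2 * F * (n : ℝ)⁻¹ ≤ ε / 2 * rate n ^ 4 := by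
      rw [← rate_pow_five]
      calc 2 * F * rate n ^ 5 = 2 * F * rate n * rate n ^ 4 := by ring
        _ ≤ _ := by gcongr
    rw [biasTerm]
    linarith
  rw [isLittleOp_iff (rate_pow_pos 4)]
  intro ε hε κ hκ
  filter_upwards [hU (ε / 8) (by positivity) (κ / 3) (by positivity),
    hA (ε / 8) (by positivity) (κ / 3) (by positivity),
    hB (ε / 8) (by positivity) (κ / 3) (by positivity), hrest (ε / 8) (by positivity),
    hh.eventually_pos, hk.eventually_pos, eventually_ge_atTop 1, rate_pow_pos 4]
    with n u1 u2 u3 hr p1 p2 hn hr4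
  set U := fun ω => (n : ℝ)⁻¹ ^ 2 * ∑ a ∈ (Finset.univ : Finset (Fin n)).offDiag,
      crossKernel (densityLaw f) (scaled K (h n)) (scaled K (k n)) (X a.1 ω) (X a.2 ω)
  set A := fun ω => (n : ℝ)⁻¹ * ∑ m : Fin n,
      ∫ x, centered (densityLaw f) (scaled K (h n)) (X m ω) x
        * bias (densityLaw f) f (scaled K (k n)) x
  set B := fun ω => (n : ℝ)⁻¹ * ∑ m : Fin n,
      ∫ x, centered (densityLaw f) (scaled K (k n)) (X m ω) x
        * bias (densityLaw f) f (scaled K (h n)) x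
  have hsub : {ω | ε * rate n ^ 4 ≤ |crossError K f (fun m : Fin n => X m ω) (h n) (k n)
      - (varTerm K n (h n) (k n) + curvature f * biasTerm K (h n) (k n))|}
      ⊆ ({ω | ε / 8 * rate n ^ 4 ≤ |U ω|} ∪ {ω | ε / 8 * rate n ^ 4 ≤ |A ω|})
        ∪ {ω | ε / 8 * rate n ^ 4 ≤ |B ω|} := by
    intro ω hω
    by_contra hcon
    simp only [Set.mem_union, Set.mem_ofPred_eq, not_or, not_le] at hcon hω
    have h1 := (hw.scaled p1).abs_cross_error_sub_le (hw.scaled p2) hf.bddIntegrable hF0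
      (densityLaw_le hF) hn (fun m : Fin n => X m ω)
    have h1' : |crossError K f (fun m : Fin n => X m ω) (h n) (k n) - varTerm K n (h n) (k n)
        - ∫ x, bias (densityLaw f) f (scaled K (h n)) x * bias (densityLaw f) f (scaled K (k n)) x|
        ≤ |U ω| + |A ω| + |B ω| + 2 * F * (n : ℝ)⁻¹ := h1
    have h2 := abs_add_le
      (crossError K f (fun m : Fin n => X m ω) (h n) (k n) - varTerm K n (h n) (k n)
        - ∫ x, bias (densityLaw f) f (scaled K (h n)) x * bias (densityLaw f) f (scaled K (k n)) x)
      ((∫ x, bias (densityLaw f) f (scaled K (h n)) x * bias (densityLaw f) f (scaled K (k n)) x)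
        - curvature f * biasTerm K (h n) (k n))
    rw [sub_add_sub_cancel, sub_sub] at h2
    nlinarith [hcon.1.1, hcon.1.2, hcon.2]
  calc _ ≤ _ := measureReal_mono hsub
    _ ≤ _ := measureReal_union_le _ _
    _ ≤ _ := add_le_add (measureReal_union_le _ _) le_rfl
    _ ≤ κ := by linarith

/-- Replacing a random bandwidth by its deterministic approximation changes the estimator
negligibly in `L²`. The majorant depends only on the sample, so that the dependence of the
bandwidth on the sample is irrelevant. -/
lemma isLittleOp_sqDiff (hK : KernelCond K) (hsupp : HasCompactSupport K) (hK2 : ContDiff ℝ 2 K)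
    (hf : DensityCond f)
    (hXm : ∀ m, Measurable (X m)) (hind : iIndepFun X P) (hlaw : ∀ m, P.map (X m) = densityLaw f)
    {h : ℕ → Ω → ℝ} (h_pos : ∀ n, 1 ≤ n → ∀ᵐ ω ∂P, 0 < h n ω)
    {k : ℕ → ℝ} {c C : ℝ} (hk : HasRate k c C)
    (hd : IsLittleOp P (fun n ω => h n ω - k n) (fun n => rate n ^ 2)) :
    IsLittleOp P (fun n ω => sqDiff K (fun m : Fin n => X m ω) (h n ω) (k n))
      (fun n => rate n ^ 4) := by
  obtain ⟨M, hw⟩ := hK.exists_window hK2.continuous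
  obtain ⟨D, hD0, hD⟩ := exists_lintegral_bandwidthMajorant_le (P := P) hK hsupp hK2 hf
  have hc0 := hk.pos
  rw [isLittleOp_iff (rate_pow_pos 4)]
  rw [isLittleOp_iff (rate_pow_pos 2)] at hd
  intro ε hε κ hκ
  -- `η` is the radius, in units of `n ^ (-2/5)`, that makes Markov's bound at most `κ / 2`
  obtain ⟨η, hη0, hη⟩ : ∃ η > 0, 2 * D * η ^ 2 ≤ ε * (κ / 2) := by
    refine ⟨Real.sqrt (ε * (κ / 2) / (2 * D + 1)), by positivity, ?_⟩
    rw [Real.sq_sqrt (by positivity), mul_div_assoc', div_le_iff₀ (by positivity)]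
    nlinarith [mul_pos hε hκ]
  filter_upwards [hd η hη0 (κ / 2) (by positivity), hk.bounds, hk.eventually_pos, rate_pos,
    eventually_ge_atTop 1, eventually_const_mul_rate_le (2 * η) hc0,
    eventually_const_mul_rate_le 1 (ε := c ^ 3) (by positivity),
    eventually_const_mul_rate_le 1 one_pos]
    with n h1 hb hkp hr hn hr1 hr2 hr3
  set δ := η * rate n ^ 2 with hδ
  have hδk : δ ≤ k n / 2 := by
    have : 2 * η * rate n * rate n ≤ c * rate n := by gcongr
    rw [hδ]
    nlinarith [hb.1]
  have hE := hD n hn (fun m => X m) (fun m => hXm m) (hind.precomp Fin.val_injective)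
    (fun m => hlaw m) (k n) δ hkp (by positivity) hδk
  have hnk : ((n : ℝ) * k n ^ 3)⁻¹ ≤ 1 := by
    rw [mul_inv, ← rate_pow_five]
    have h3 : (k n ^ 3)⁻¹ ≤ ((c * rate n) ^ 3)⁻¹ :=
      inv_anti₀ (by positivity) (pow_le_pow_left₀ (by positivity) hb.1 3)
    calc rate n ^ 5 * (k n ^ 3)⁻¹ ≤ rate n ^ 5 * ((c * rate n) ^ 3)⁻¹ := by gcongr
      _ = rate n ^ 2 / c ^ 3 := by field_simp
      _ ≤ 1 := by
        rw [div_le_one (by positivity)]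
        nlinarith
  have hE2 : ∫⁻ ω, bandwidthMajorant K (k n) δ (fun m : Fin n => X m ω) ∂P
      ≤ ENNReal.ofReal (2 * D * η ^ 2 * rate n ^ 4) := by
    refine hE.trans (ENNReal.ofReal_le_ofReal ?_)
    calc D * δ ^ 2 * (((n : ℝ) * k n ^ 3)⁻¹ + 1) ≤ D * δ ^ 2 * (1 + 1) := by gcongr
      _ = _ := by rw [hδ]; ring
  have hmX : Measurable fun ω => (fun m : Fin n => X m ω) :=
    measurable_pi_lambda _ fun m => hXm m
  have hmarkov : P.real {ω | ENNReal.ofReal (ε * rate n ^ 4)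
      ≤ bandwidthMajorant K (k n) δ (fun m : Fin n => X m ω)} ≤ κ / 2 := by
    have h2 := meas_ge_le_lintegral_div (μ := P)
      ((measurable_bandwidthMajorant hK2 (k n) δ).comp hmX).aemeasurable
      (ε := ENNReal.ofReal (ε * rate n ^ 4)) (by simp; positivity) (by simp)
    refine ENNReal.toReal_le_of_le_ofReal (by positivity) (h2.trans ?_)
    refine ENNReal.div_le_of_le_mul (hE2.trans ?_)
    rw [← ENNReal.ofReal_mul (by positivity)]
    refine ENNReal.ofReal_le_ofReal ?_
    calc 2 * D * η ^ 2 * rate n ^ 4 ≤ ε * (κ / 2) * rate n ^ 4 := by gcongr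
      _ = _ := by ring
  have hsub : {ω | ε * rate n ^ 4 ≤ |sqDiff K (fun m : Fin n => X m ω) (h n ω) (k n)|}
      ≤ᵐ[P] ({ω | η * rate n ^ 2 ≤ |h n ω - k n|} ∪ {ω | ENNReal.ofReal (ε * rate n ^ 4)
        ≤ bandwidthMajorant K (k n) δ (fun m : Fin n => X m ω)} : Set Ω) := by
    filter_upwards [h_pos n hn] with ω hpos hω
    by_cases hclose : |h n ω - k n| ≤ δ
    · right
      have h5 : ε * rate n ^ 4 ≤ |sqDiff K (fun m : Fin n => X m ω) (h n ω) (k n)| := hω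
      have h6 := lintegral_empirical_sub_sq_le hK2 (fun m : Fin n => X m ω) hpos hkp hclose
      rw [← ofReal_integral_sq (((hw.scaled hpos).empirical_bddIntegrable _).sub
        ((hw.scaled hkp).empirical_bddIntegrable _)).memLp] at h6
      refine (ENNReal.ofReal_le_ofReal ?_).trans h6
      rwa [sqDiff, abs_of_nonneg (integral_nonneg fun x => sq_nonneg _)] at h5
    · left
      exact (not_le.1 hclose).le
  calc _ ≤ _ := ENNReal.toReal_mono (measure_ne_top _ _) (measure_mono_ae hsub)
    _ ≤ _ := measureReal_union_le _ _
    _ ≤ κ := by linarith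

/-- The variance term at deterministic bandwidths is of order `n ^ (-4/5)`, and so is the bias
term. -/
lemma exists_eventually_terms_le (hK : KernelCond K) (hc : Continuous K)
    {k : ℕ → ℝ} {c C : ℝ} (hk : HasRate k c C) (γ : ℝ) :
    ∃ B, 0 ≤ B ∧ ∀ᶠ n in atTop, varTerm K n (k n) (k n) + γ * biasTerm K (k n) (k n)
      ≤ B * rate n ^ 4 := by
  obtain ⟨M, hw⟩ := hK.exists_window hc
  have hM0 := hw.bound_nonneg
  have hc0 := hk.pos
  refine ⟨c⁻¹ * M + |γ| * (1 / 4 * C ^ 4 * secondMoment K ^ 2), by positivity, ?_⟩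
  filter_upwards [hk.bounds, hk.eventually_pos, rate_pos, eventually_ge_atTop 1] with n hb hkp hr hn
  have h1 : ∫ u, scaled K (k n) u * scaled K (k n) u ≤ c⁻¹ * (rate n)⁻¹ * M := by
    have hp := hw.scaled hkp
    have h2 := integral_mono ((hw.scaled_bddIntegrable hkp).integrable_mul
      (hw.scaled_bddIntegrable hkp)) (hp.density.integrable.mul_const ((k n)⁻¹ * M))
      fun u => mul_le_mul_of_nonneg_left (hp.le u) (hp.density.nonneg u)
    rw [integral_mul_const, hp.density.integral_eq_one, one_mul] at h2
    refine h2.trans ?_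
    gcongr
    rw [← mul_inv]
    exact inv_anti₀ (by positivity) hb.1
  have h3 : varTerm K n (k n) (k n) ≤ c⁻¹ * M * rate n ^ 4 := by
    rw [varTerm, ← rate_pow_five]
    calc _ ≤ rate n ^ 5 * (c⁻¹ * (rate n)⁻¹ * M) := by gcongr
      _ = _ := by field_simp
  have h4 : γ * biasTerm K (k n) (k n)
      ≤ |γ| * (1 / 4 * C ^ 4 * secondMoment K ^ 2) * rate n ^ 4 := by
    have h5 : k n ^ 4 ≤ (C * rate n) ^ 4 := pow_le_pow_left₀ hkp.le hb.2 4
    calc γ * biasTerm K (k n) (k n) ≤ |γ| * biasTerm K (k n) (k n) := by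
          gcongr
          · unfold biasTerm; positivity
          · exact le_abs_self γ
      _ = |γ| * (1 / 4 * k n ^ 4 * secondMoment K ^ 2) := by rw [biasTerm]; ring
      _ ≤ |γ| * (1 / 4 * (C * rate n) ^ 4 * secondMoment K ^ 2) := by gcongr
      _ = _ := by ring
  linarith

/-- The variation of an inner product, in terms of square norms. -/
lemma abs_integral_mul_sub_le {u v u₀ v₀ : ℝ → ℝ} (hu : BddIntegrable u) (hv : BddIntegrable v)
    (hu₀ : BddIntegrable u₀) (hv₀ : BddIntegrable v₀) {η : ℝ} (hη : 0 < η) :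
    |(∫ x, u x * v x) - ∫ x, u₀ x * v₀ x|
      ≤ η / 2 * ((∫ x, u₀ x * u₀ x) + ∫ x, v₀ x * v₀ x)
        + (1 / (2 * η) + 1 / 2) * ((∫ x, (u x - u₀ x) ^ 2) + ∫ x, (v x - v₀ x) ^ 2) := by
  have du := hu.sub hu₀
  have dv := hv.sub hv₀
  have e : (∫ x, u x * v x) - ∫ x, u₀ x * v₀ x = (∫ x, v₀ x * (u x - u₀ x))
      + (∫ x, u₀ x * (v x - v₀ x)) + ∫ x, (u x - u₀ x) * (v x - v₀ x) := by
    have i3 : Integrable fun x => v₀ x * (u x - u₀ x) + u₀ x * (v x - v₀ x) :=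
      (hv₀.integrable_mul du).add (hu₀.integrable_mul dv)
    rw [← integral_sub (hu.integrable_mul hv) (hu₀.integrable_mul hv₀),
      ← integral_add (hv₀.integrable_mul du) (hu₀.integrable_mul dv),
      ← integral_add i3 (du.integrable_mul dv)]
    refine integral_congr_ae (.of_forall fun x => ?_)
    simp only
    ring
  have b1 := abs_integral_mul_le hv₀.memLp du.memLp hη
  have b2 := abs_integral_mul_le hu₀.memLp dv.memLp hη
  have b3 := abs_integral_mul_le du.memLp dv.memLp one_pos
  rw [e]
  simp only [← sq]
  refine (abs_add_three _ _ _).trans ?_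
  linarith

/-- The cross error at random bandwidths is that at the deterministic approximations. -/
lemma isLittleOp_crossError_sub (hK : KernelCond K) (hsupp : HasCompactSupport K)
    (hK2 : ContDiff ℝ 2 K) (hf : DensityCond f)
    (hXm : ∀ m, Measurable (X m)) (hind : iIndepFun X P) (hlaw : ∀ m, P.map (X m) = densityLaw f)
    {h k : ℕ → Ω → ℝ} (h_pos : ∀ n, 1 ≤ n → ∀ᵐ ω ∂P, 0 < h n ω)
    (k_pos : ∀ n, 1 ≤ n → ∀ᵐ ω ∂P, 0 < k n ω)
    {h₀ k₀ : ℕ → ℝ} {c C c' C' : ℝ} (hh₀ : HasRate h₀ c C) (hk₀ : HasRate k₀ c' C')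
    (hh : IsLittleOp P (fun n ω => h n ω - h₀ n) (fun n => rate n ^ 2))
    (hk : IsLittleOp P (fun n ω => k n ω - k₀ n) (fun n => rate n ^ 2)) :
    IsLittleOp P (fun n ω => crossError K f (fun m : Fin n => X m ω) (h n ω) (k n ω)
      - crossError K f (fun m : Fin n => X m ω) (h₀ n) (k₀ n)) (fun n => rate n ^ 4) := by
  have hc := hK2.continuous
  obtain ⟨M, hw⟩ := hK.exists_window hc
  have hr4 := rate_pow_pos 4
  have s1 := isLittleOp_sqDiff hK hsupp hK2 hf hXm hind hlaw h_pos hh₀ hh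
  have s2 := isLittleOp_sqDiff hK hsupp hK2 hf hXm hind hlaw k_pos hk₀ hk
  have t1 := isLittleOp_crossError_deterministic hK hc hsupp hf hXm hind hlaw hh₀ hh₀
  have t2 := isLittleOp_crossError_deterministic hK hc hsupp hf hXm hind hlaw hk₀ hk₀
  obtain ⟨B, hB0, hB⟩ := exists_eventually_terms_le hK hc hh₀ (curvature f)
  obtain ⟨B', hB0', hB'⟩ := exists_eventually_terms_le hK hc hk₀ (curvature f)
  refine .of_approx hr4 fun θ hθ => ?_
  obtain ⟨η, hη0, hη⟩ : ∃ η > 0, η / 2 * (B + B') ≤ θ :=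
    ⟨θ / (B + B' + 1), by positivity, by
      rw [div_div, div_mul_eq_mul_div, div_le_iff₀ (by positivity)]
      nlinarith⟩
  refine ⟨_, ((t1.add hr4 t2).const_mul hr4 (η / 2)).add hr4
    ((s1.add hr4 s2).const_mul hr4 (1 / (2 * η) + 1 / 2)), ?_⟩
  filter_upwards [hB, hB', hh₀.eventually_pos, hk₀.eventually_pos, eventually_ge_atTop 1, hr4]
    with n hBn hBn' hp kp hn hr
  filter_upwards [h_pos n hn, k_pos n hn] with ω hω kω
  have hb : ∀ {a : ℝ}, 0 < a → BddIntegrable fun x =>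
      empirical (scaled K a) (fun m : Fin n => X m ω) x - f x := fun ha =>
    ((hw.scaled ha).empirical_bddIntegrable _).sub hf.bddIntegrable
  have hmain := abs_integral_mul_sub_le (hb hω) (hb kω) (hb hp) (hb kp) hη0
  simp only [sub_sub_sub_cancel_right] at hmain
  refine hmain.trans (le_trans ?_ (add_le_add le_rfl (le_abs_self _)))
  simp only [crossError, sqDiff]
  have hfin : η / 2 * (B * rate n ^ 4 + B' * rate n ^ 4) ≤ θ * rate n ^ 4 := by
    calc _ = η / 2 * (B + B') * rate n ^ 4 := by ring
      _ ≤ _ := by gcongr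
  have hfin2 : η / 2 * ((varTerm K n (h₀ n) (h₀ n) + curvature f * biasTerm K (h₀ n) (h₀ n))
      + (varTerm K n (k₀ n) (k₀ n) + curvature f * biasTerm K (k₀ n) (k₀ n)))
      ≤ η / 2 * (B * rate n ^ 4 + B' * rate n ^ 4) := by gcongr
  linarith

/-- The variance term is Lipschitz in the bandwidths: a displacement of `n ^ (-2/5)` changes it by
`O(1/n)`. -/
lemma isLittleOp_varTerm_sub (hK : KernelCond K) (hsupp : HasCompactSupport K)
    (hK2 : ContDiff ℝ 2 K)
    {h k : ℕ → Ω → ℝ} (h_pos : ∀ n, 1 ≤ n → ∀ᵐ ω ∂P, 0 < h n ω)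
    (k_pos : ∀ n, 1 ≤ n → ∀ᵐ ω ∂P, 0 < k n ω)
    {h₀ k₀ : ℕ → ℝ} {c C c' C' : ℝ} (hh₀ : HasRate h₀ c C) (hk₀ : HasRate k₀ c' C')
    (hh : IsLittleOp P (fun n ω => h n ω - h₀ n) (fun n => rate n ^ 2))
    (hk : IsLittleOp P (fun n ω => k n ω - k₀ n) (fun n => rate n ^ 2)) :
    IsLittleOp P (fun n ω => varTerm K n (h n ω) (k n ω) - varTerm K n (h₀ n) (k₀ n))
      (fun n => rate n ^ 4) := by
  obtain ⟨M, hw⟩ := hK.exists_window hK2.continuous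
  obtain ⟨D, hD0, hD⟩ := exists_abs_scaled_sub_le hsupp hK2
  have hc0 := hh₀.pos
  have hc0' := hk₀.pos
  refine .of_close (rate_pow_pos 4) (rate_pow_pos 2) hh hk fun ε hε => ?_
  filter_upwards [hh₀.bounds, hk₀.bounds, hh₀.eventually_pos, hk₀.eventually_pos, rate_pos,
    eventually_ge_atTop 1, eventually_const_mul_rate_le 2 hc0, eventually_const_mul_rate_le 2 hc0',
    eventually_const_mul_rate_le (D * (c ^ 2)⁻¹ + D * (c' ^ 2)⁻¹) hε]
    with n hb kb hp kp hr hn hr1 hr2 hr3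
  filter_upwards [h_pos n hn, k_pos n hn] with ω hω kω hclose kclose
  -- a displacement of `n ^ (-2/5)` moves the rescaled kernel by a bounded amount
  have key : ∀ {a a₀ b : ℝ}, 0 < b → 0 < a₀ → b * rate n ≤ a₀ → 2 * rate n ≤ b →
      |a - a₀| ≤ rate n ^ 2 → ∀ u, |scaled K a u - scaled K a₀ u| ≤ D * (b ^ 2)⁻¹ := by
    intro a a₀ b hb0 ha₀ hba hrb hcl u
    have h1 : |a - a₀| ≤ a₀ / 2 := by nlinarith
    refine (hD a a₀ ha₀ h1 u).trans ?_
    gcongr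
    have h2 : (a₀ ^ 2)⁻¹ ≤ ((b * rate n) ^ 2)⁻¹ :=
      inv_anti₀ (by positivity) (pow_le_pow_left₀ (by positivity) hba 2)
    calc |a - a₀| * (a₀ ^ 2)⁻¹ ≤ rate n ^ 2 * ((b * rate n) ^ 2)⁻¹ := by gcongr
      _ = _ := by field_simp
  have k1 := key hc0 hp hb.1 hr1 hclose
  have k2 := key hc0' kp kb.1 hr2 kclose
  have ih := hw.scaled_bddIntegrable hω
  have ik := hw.scaled_bddIntegrable kω
  have ih₀ := hw.scaled_bddIntegrable hp
  have ik₀ := hw.scaled_bddIntegrable kp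
  have hint : |(∫ u, scaled K (h n ω) u * scaled K (k n ω) u)
      - ∫ u, scaled K (h₀ n) u * scaled K (k₀ n) u| ≤ D * (c ^ 2)⁻¹ + D * (c' ^ 2)⁻¹ := by
    rw [← integral_sub (ih.integrable_mul ik) (ih₀.integrable_mul ik₀)]
    have hg : Integrable fun u => D * (c ^ 2)⁻¹ * scaled K (k n ω) u
        + D * (c' ^ 2)⁻¹ * scaled K (h₀ n) u :=
      (ik.integrable.const_mul _).add (ih₀.integrable.const_mul _)
    have := norm_integral_le_of_norm_le (f := fun u => scaled K (h n ω) u * scaled K (k n ω) u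
        - scaled K (h₀ n) u * scaled K (k₀ n) u) hg (.of_forall fun u => ?_)
    · rw [integral_add (ik.integrable.const_mul _) (ih₀.integrable.const_mul _),
        integral_const_mul, integral_const_mul, (hw.scaled kω).density.integral_eq_one,
        (hw.scaled hp).density.integral_eq_one, mul_one, mul_one] at this
      exact this
    · have e : scaled K (h n ω) u * scaled K (k n ω) u - scaled K (h₀ n) u * scaled K (k₀ n) u
          = (scaled K (h n ω) u - scaled K (h₀ n) u) * scaled K (k n ω) u
            + (scaled K (k n ω) u - scaled K (k₀ n) u) * scaled K (h₀ n) u := by ring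
      have n1 := (hw.scaled kω).density.nonneg u
      have n2 := (hw.scaled hp).density.nonneg u
      rw [e, Real.norm_eq_abs]
      refine (abs_add_le _ _).trans ?_
      rw [abs_mul, abs_mul, abs_of_nonneg n1, abs_of_nonneg n2]
      have := k1 u
      have := k2 u
      gcongr
  rw [varTerm, varTerm, ← mul_sub, abs_mul, abs_of_nonneg (by positivity), ← rate_pow_five]
  calc _ ≤ rate n ^ 5 * (D * (c ^ 2)⁻¹ + D * (c' ^ 2)⁻¹) := by gcongr
    _ = (D * (c ^ 2)⁻¹ + D * (c' ^ 2)⁻¹) * rate n * rate n ^ 4 := by ring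
    _ ≤ _ := by gcongr

lemma isLittleOp_biasTerm_sub
    {h k : ℕ → Ω → ℝ} (h_pos : ∀ n, 1 ≤ n → ∀ᵐ ω ∂P, 0 < h n ω)
    (k_pos : ∀ n, 1 ≤ n → ∀ᵐ ω ∂P, 0 < k n ω)
    {h₀ k₀ : ℕ → ℝ} {c C c' C' : ℝ} (hC : 0 < C) (hC' : 0 < C')
    (hh₀ : HasRate h₀ c C) (hk₀ : HasRate k₀ c' C')
    (hh : IsLittleOp P (fun n ω => h n ω - h₀ n) (fun n => rate n ^ 2))
    (hk : IsLittleOp P (fun n ω => k n ω - k₀ n) (fun n => rate n ^ 2)) :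
    IsLittleOp P (fun n ω => biasTerm K (h n ω) (k n ω) - biasTerm K (h₀ n) (k₀ n))
      (fun n => rate n ^ 4) := by
  refine .of_close (rate_pow_pos 4) (rate_pow_pos 2) hh hk fun ε hε => ?_
  set G := 1 / 4 * ((2 * C + 1) * (C' + 1) ^ 2 + C ^ 2 * (2 * C' + 1)) * secondMoment K ^ 2
  filter_upwards [hh₀.bounds, hk₀.bounds, hh₀.eventually_pos, hk₀.eventually_pos, rate_pos,
    eventually_ge_atTop 1, eventually_const_mul_rate_le 1 one_pos,
    eventually_const_mul_rate_le G hε] with n hb kb hp kp hr hn hr1 hr2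
  filter_upwards [h_pos n hn, k_pos n hn] with ω hω kω hclose kclose
  have key : ∀ {a a₀ b : ℝ}, 0 < a → 0 < a₀ → 0 < b → a₀ ≤ b * rate n → |a - a₀| ≤ rate n ^ 2 →
      a ≤ (b + 1) * rate n ∧ |a ^ 2 - a₀ ^ 2| ≤ (2 * b + 1) * rate n ^ 3 := by
    intro a a₀ b ha ha₀ hb0 hle hcl
    have h1 : a ≤ (b + 1) * rate n := by nlinarith [(abs_le.1 hcl).2]
    refine ⟨h1, ?_⟩
    have e : a ^ 2 - a₀ ^ 2 = (a - a₀) * (a + a₀) := by ring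
    rw [e, abs_mul, abs_of_pos (by positivity : 0 < a + a₀)]
    calc |a - a₀| * (a + a₀) ≤ rate n ^ 2 * ((2 * b + 1) * rate n) := by
          gcongr
          linarith
      _ = _ := by ring
  have k1 := key hω hp hC hb.2 hclose
  have k2 := key kω kp hC' kb.2 kclose
  have e : biasTerm K (h n ω) (k n ω) - biasTerm K (h₀ n) (k₀ n)
      = 1 / 4 * ((h n ω ^ 2 - h₀ n ^ 2) * k n ω ^ 2 + h₀ n ^ 2 * (k n ω ^ 2 - k₀ n ^ 2))
        * secondMoment K ^ 2 := by
    simp only [biasTerm]; ring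
  have hle : |(h n ω ^ 2 - h₀ n ^ 2) * k n ω ^ 2 + h₀ n ^ 2 * (k n ω ^ 2 - k₀ n ^ 2)|
      ≤ ((2 * C + 1) * (C' + 1) ^ 2 + C ^ 2 * (2 * C' + 1)) * rate n ^ 5 := by
    refine (abs_add_le _ _).trans ?_
    rw [abs_mul, abs_mul, abs_of_nonneg (sq_nonneg (k n ω)), abs_of_nonneg (sq_nonneg (h₀ n))]
    calc _ ≤ (2 * C + 1) * rate n ^ 3 * ((C' + 1) * rate n) ^ 2
          + (C * rate n) ^ 2 * ((2 * C' + 1) * rate n ^ 3) := by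
          have := k1.2
          have := k2.1
          have := k2.2
          have := hb.2
          gcongr
      _ = _ := by ring
  rw [e, abs_mul, abs_mul, abs_of_nonneg (sq_nonneg (secondMoment K)),
    abs_of_nonneg (by norm_num : (0 : ℝ) ≤ 1 / 4)]
  calc _ ≤ 1 / 4 * (((2 * C + 1) * (C' + 1) ^ 2 + C ^ 2 * (2 * C' + 1)) * rate n ^ 5)
        * secondMoment K ^ 2 := by gcongr
    _ = G * rate n * rate n ^ 4 := by simp only [G]; ring
    _ ≤ _ := by gcongr

/-- The expansion of the integrated cross error for random bandwidths. -/
lemma isLittleOp_crossError (hK : KernelCond K) (hsupp : HasCompactSupport K)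
    (hK2 : ContDiff ℝ 2 K) (hf : DensityCond f)
    (hXm : ∀ m, Measurable (X m)) (hind : iIndepFun X P) (hlaw : ∀ m, P.map (X m) = densityLaw f)
    {h k : ℕ → Ω → ℝ} (h_pos : ∀ n, 1 ≤ n → ∀ᵐ ω ∂P, 0 < h n ω)
    (k_pos : ∀ n, 1 ≤ n → ∀ᵐ ω ∂P, 0 < k n ω)
    {h₀ k₀ : ℕ → ℝ} {c C c' C' : ℝ} (hC : 0 < C) (hC' : 0 < C')
    (hh₀ : HasRate h₀ c C) (hk₀ : HasRate k₀ c' C')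
    (hh : IsLittleOp P (fun n ω => h n ω - h₀ n) (fun n => rate n ^ 2))
    (hk : IsLittleOp P (fun n ω => k n ω - k₀ n) (fun n => rate n ^ 2)) :
    IsLittleOp P (fun n ω => crossError K f (fun m : Fin n => X m ω) (h n ω) (k n ω)
      - (varTerm K n (h n ω) (k n ω) + curvature f * biasTerm K (h n ω) (k n ω)))
      (fun n => rate n ^ 4) := by
  have hr4 := rate_pow_pos 4
  have a1 := isLittleOp_crossError_sub hK hsupp hK2 hf hXm hind hlaw h_pos k_pos hh₀ hk₀ hh hk
  have a2 := isLittleOp_crossError_deterministic hK hK2.continuous hsupp hf hXm hind hlaw hh₀ hk₀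
  have a3 := isLittleOp_varTerm_sub hK hsupp hK2 h_pos k_pos hh₀ hk₀ hh hk
  have a4 := isLittleOp_biasTerm_sub (K := K) h_pos k_pos hC hC' hh₀ hk₀ hh hk
  have := ((a1.add hr4 a2).add hr4 (a3.const_mul hr4 (-1))).add hr4
    (a4.const_mul hr4 (-curvature f))
  refine (congrArg (fun Y => IsLittleOp P Y fun n => rate n ^ 4) ?_).mp this
  funext n ω
  ring

end Expansion

end KDE

end

theorem proposition2p1 {Ω : Type*} [MeasurableSpace Ω] (P : MeasureTheory.Measure Ω)
    [MeasureTheory.IsProbabilityMeasure P]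
    (K f : ℝ → ℝ) (hK : KDE.KernelCond K) (hf : KDE.DensityCond f)
    (hK_supp : HasCompactSupport K) (hK_smooth : ContDiff ℝ 2 K)
    (X : ℕ → Ω → ℝ) (hX_indep : ProbabilityTheory.iIndepFun X P)
    (hX_law : ∀ m, ProbabilityTheory.HasLaw (X m)
      (MeasureTheory.volume.withDensity fun x => ENNReal.ofReal (f x)) P)
    (k : ℕ) (h : ℕ → Ω → Fin k → ℝ)
    (h_meas : ∀ n i, AEMeasurable (fun ω => h n ω i) P)
    (h_pos : ∀ n, 1 ≤ n → ∀ i, ∀ᵐ ω ∂P, 0 < h n ω i)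
    (h_star : ∀ i, ∃ hs : ℕ → ℝ, (∀ n, 1 ≤ n → 0 < hs n) ∧
      Asymptotics.IsTheta Filter.atTop hs (fun n => (n : ℝ) ^ (-(1 / 5) : ℝ)) ∧
      KDE.IsLittleOp P (fun n ω => h n ω i - hs n) (fun n => (n : ℝ) ^ (-(2 / 5) : ℝ))) :
    ∀ i j, KDE.IsLittleOp P
      (fun n ω => (KDE.gram K f (fun m : Fin n => X m ω) (h n ω)
        - (KDE.matA K n (h n ω) + KDE.curvature f • KDE.matB K (h n ω))) i j)
      (fun n => (n : ℝ) ^ (-(4 / 5) : ℝ)) := by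
  intro i j
  obtain ⟨hi, hi0, hiΘ, hio⟩ := h_star i
  obtain ⟨hj, hj0, hjΘ, hjo⟩ := h_star j
  obtain ⟨c, C, hC, hri⟩ := KDE.exists_hasRate hi0 hiΘ
  obtain ⟨c', C', hC', hrj⟩ := KDE.exists_hasRate hj0 hjΘ
  have e2 : (fun n : ℕ => (n : ℝ) ^ (-(2 / 5) : ℝ)) = fun n => KDE.rate n ^ 2 := by
    funext n
    rw [KDE.rate_pow]
    norm_num
  have e4 : (fun n : ℕ => (n : ℝ) ^ (-(4 / 5) : ℝ)) = fun n => KDE.rate n ^ 4 := by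
    funext n
    rw [KDE.rate_pow]
    norm_num
  rw [e2] at hio hjo
  rw [e4]
  -- the observations may be replaced by measurable versions
  let X' : ℕ → Ω → ℝ := fun m => (hX_law m).aemeasurable.mk (X m)
  have hXX' : ∀ m, X m =ᵐ[P] X' m := fun m => (hX_law m).aemeasurable.ae_eq_mk
  have hX'm : ∀ m, Measurable (X' m) := fun m => (hX_law m).aemeasurable.measurable_mk
  have hX'law : ∀ m, P.map (X' m) = KDE.densityLaw f := fun m => by
    rw [← MeasureTheory.Measure.map_congr (hXX' m)]
    exact (hX_law m).map_eq
  have hmain := KDE.isLittleOp_crossError hK hK_supp hK_smooth hf hX'm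
    (hX_indep.congr hXX') hX'law (fun n hn => h_pos n hn i) (fun n hn => h_pos n hn j)
    hC hC' hri hrj hio hjo
  refine MeasureTheory.TendstoInMeasure.congr_left (fun n => ?_) hmain
  filter_upwards [MeasureTheory.ae_all_iff.2 hXX'] with ω hω
  have hA : ∀ a b : ℝ, ((n : ℝ) * a * b)⁻¹ * ∫ u, K (u / a) * K (u / b)
      = KDE.varTerm K n a b := by
    intro a b
    rw [KDE.varTerm, ← MeasureTheory.integral_const_mul, ← MeasureTheory.integral_const_mul]
    refine MeasureTheory.integral_congr_ae (.of_forall fun u => ?_)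
    simp only [KDE.scaled, div_eq_inv_mul, mul_inv]
    ring
  simp only [KDE.gram, KDE.matA, KDE.matB, Matrix.sub_apply, Matrix.add_apply, Matrix.smul_apply,
    Matrix.of_apply, smul_eq_mul, hA, KDE.estimator_eq_empirical, hω]
  rfl
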